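/- Let $H$ be a finite-dimensional Hopf algebra over a field $\Bbbk$ with comultiplication $\Delta(h)=h_{(1)}\otimes h_{(2)}$, counit $\varepsilon$ and antipode $S$. Fix a non-zero right cointegral $\lambda_H : H \to \Bbbk$, i.e. a linear map with $\lambda_H(h_{(1)})h_{(2)}=\lambda_H(h)1$ for all $h\in H$, and a non-zero left integral $\Lambda\in H$, i.e. $h\Lambda=\varepsilon(h)\Lambda$ for all $h\in H$. Let $g_H\in H$ be the distinguished grouplike element, determined by $h_{(1)}\lambda_H(h_{(2)})=\lambda_H(h)g_H$, and let $\alpha_H:H\to\Bbbk$ be the left modular function, determined by $\Lambda h=\alpha_H(h)\Lambda$ ($h\in H$). Let $\mathcal{C}$ be the category of finite-dimensional left $H$-comodules, with coactions written $m\mapsto m_{(-1)}\otimes m_{(0)}$, and let $A$ and $B$ be algebras in $\mathcal{C}$, i.e. finite-dimensional left $H$-comodule algebras. Let ${}_A\mathcal{C}_B$ be the category of $A$-$B$-bimodules in $\mathcal{C}$ (relative Hopf bimodules). For each $X\in\{A,B\}$, let $g_X\in H$ be a grouplike element and $\lambda_X:X\to\Bbbk$ a non-degenerate $g_X$-cointegral,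 i.e. a linear map such that $x_{(-1)}\lambda_X(x_{(0)})=\lambda_X(x)g_X$ for all $x\in X$ and such that $X\to X^*$, $x\mapsto\lambda_X(x\,\cdot\,)$, is bijective. Let $\nu_X:X\to X$ be the associated Nakayama automorphism, determined by $\lambda_X(yx)=\lambda_X(\nu_X(x)y)$ for all $x,y\in X$. For $b \in B$ write $b\leftharpoonup\alpha_H=\alpha_H(b_{(-1)})b_{(0)}$. For $M\in{}_A\mathcal{C}_B$ let $\mathrm{N}(M)$ be the vector space $M$ with the left coaction $$m\mapsto g_A^{-1}S^2(m_{(-1)})g_B^{-1}g_H\otimes m_{(0)}$$ of $H$ and the actions $$a\triangleright m\triangleleft b=\nu_A(a)\cdot m\cdot\nu_B^{-1}(b\leftharpoonup\alpha_H)\qquad(a\in A,\ b\in B,\ m\in M)$$ of $A$ and $B$, where $\cdot$ denotes the original actions, and let $\mathrm{N}(f)=f$ as a linear map for every morphism $f$ of ${}_A\mathcal{C}_B$. Then $\mathrm{N}(M)$ is an object of ${}_A\mathcal{C}_B$ for every $M\in{}_A\mathcal{C}_B$, and the functor $\mathrm{N}:{}_A\mathcal{C}_B\to{}_A\mathcal{C}_B$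 is (isomorphic to) the Nakayama functor of ${}_A\mathcal{C}_B$, that is, the functor $$M\mapsto\int^{X\in{}_A\mathcal{C}_B}\mathrm{Hom}_{{}_A\mathcal{C}_B}(M,X)^*\odot X,$$ where the integral is a coend and $\odot$ is the copower: for each $X$, the functor $V\mapsto V\odot X$ on finite-dimensional vector spaces is left adjoint to $\mathrm{Hom}_{{}_A\mathcal{C}_B}(X,-)$. -/

import Mathlib

open scoped TensorProduct
open CategoryTheory Opposite

universe u w

/-! ### The Nakayama functor of a linear category with finite-dimensional Hom spaces -/

section NakayamaFunctor

variable (k : Type u) [Field k] (C : Type w) [Category.{u} C] [Preadditive C] [Linear k C]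

/-- All Hom spaces are finite-dimensional. -/
class HomFinite : Prop where
  finite : ∀ X Y : C, Module.Finite k (X ⟶ Y)

attribute [instance] HomFinite.finite

variable [HomFinite k C]

/-- The Hom functor `Cᵒᵖ ⥤ C ⥤ Vect`, `(M, X) ↦ Hom(M, X)`, into finite-dimensional spaces. -/
def homFunctor : Cᵒᵖ ⥤ C ⥤ FGModuleCat.{u} k where
  obj M :=
    { obj := fun X => FGModuleCat.of k (M.unop ⟶ X)
      map := fun f => FGModuleCat.ofHom (Linear.rightComp k M.unop f)
      map_id := fun X => by ext f; exact Category.comp_id f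
      map_comp := fun f g => by ext h; exact (Category.assoc h f g).symm }
  map {M M'} f :=
    { app := fun X => FGModuleCat.ofHom (Linear.leftComp k X f.unop)
      naturality := fun X Y g => by ext h; exact (Category.assoc f.unop h g).symm }
  map_id M := by ext X f; exact Category.id_comp f
  map_comp f g := by ext X h; exact Category.assoc g.unop f.unop h

/-- The functor `C ⥤ Cᵒᵖ ⥤ Vect`, `(M, X) ↦ Hom(M, X)^*`. -/
def dualHomFunctor : C ⥤ Cᵒᵖ ⥤ FGModuleCat.{u} k where
  obj M :=
    { obj := fun X => FGModuleCat.of k (Module.Dual k (M ⟶ X.unop))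
      map := fun f => FGModuleCat.ofHom (Linear.rightComp k M f.unop).dualMap
      map_id := fun X => by
        ext φ f
        exact congrArg φ (Category.comp_id f)
      map_comp := fun f g => by
        ext φ h
        exact congrArg φ (Category.assoc h g.unop f.unop).symm }
  map {M M'} f :=
    { app := fun X => FGModuleCat.ofHom (Linear.leftComp k X.unop f).dualMap
      naturality := fun X Y g => by
        ext φ h
        exact congrArg φ (Category.assoc f h g.unop) }
  map_id M := by
    ext X φ f
    exact congrArg φ (Category.id_comp f)
  map_comp f g := by
    ext X φ h
    exact congrArg φ (Category.assoc f g h)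

variable {C}

/-- Given a bifunctor `copower : (X, V) ↦ V ⊙ X`, this is the functor sending `M` to the bifunctor
`(X, Y) ↦ Hom(M, X)^* ⊙ Y`, contravariant in `X` and covariant in `Y`. -/
def nakayamaIntegrand (copower : C ⥤ FGModuleCat.{u} k ⥤ C) : C ⥤ Cᵒᵖ ⥤ C ⥤ C :=
  dualHomFunctor k C ⋙ (Functor.whiskeringRight _ _ _).obj copower.flip

/-- The endofunctor `N` is the Nakayama functor `M ↦ ∫^{X ∈ C} Hom(M, X)^* ⊙ X` of the `k`-linear
category `C`. Here `⊙` is the copower, that is, `- ⊙ X` is left adjoint to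
`Hom(X, -) : C ⥤ Vect`, naturally in `X`. The coend is
the point of a universal cowedge, and `N` acts on morphisms as induced from the functoriality
of `Hom(M, X)^* ⊙ X` in `M`. As coends are determined up to isomorphism, `N` is only required to be
isomorphic to the functor given by the coends. -/
def IsNakayamaFunctor (N : C ⥤ C) : Prop :=
  ∃ copower : C ⥤ FGModuleCat.{u} k ⥤ C, Nonempty (copower ⊣₂ homFunctor k C) ∧
    ∃ c : ∀ M : C, Limits.Cowedge ((nakayamaIntegrand k copower).obj M),
      (∀ M, Nonempty (Limits.IsColimit (c M))) ∧
      ∃ e : ∀ M : C, (c M).pt ≅ N.obj M,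
        ∀ ⦃M M' : C⦄ (f : M ⟶ M') (X : C),
          (((nakayamaIntegrand k copower).map f).app (op X)).app X ≫ (c M').π X ≫ (e M').hom =
            (c M).π X ≫ (e M).hom ≫ N.map f

end NakayamaFunctor

/-! ### Comodules, comodule algebras and cointegrals -/

section Comodule

variable (k H : Type u) [Field k] [Ring H] [HopfAlgebra k H]

variable {k H} in
/-- `δ : M → H ⊗ M` is a coassociative and counital left coaction. -/
structure IsLeftCoaction {M : Type u} [AddCommGroup M] [Module k M]
    (δ : M →ₗ[k] H ⊗[k] M) : Prop where
  coassoc : (TensorProduct.assoc k H H M).toLinearMap ∘ₗ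
    (Coalgebra.comul (R := k) (A := H)).rTensor M ∘ₗ δ = δ.lTensor H ∘ₗ δ
  counit : (TensorProduct.lid k M).toLinearMap ∘ₗ
    (Coalgebra.counit (R := k) (A := H)).rTensor M ∘ₗ δ = LinearMap.id

/-- A left `H`-comodule algebra: an algebra with a left `H`-coaction that is an algebra map. -/
class LeftComoduleAlgebra (A : Type u) [Ring A] [Algebra k A] where
  coaction : A →ₐ[k] H ⊗[k] A
  isLeftCoaction : IsLeftCoaction coaction.toLinearMap

variable {A : Type u} [Ring A] [Algebra k A]

variable {k H} in
/-- The map `a ↦ a_{(-1)} ⟨f, a_{(0)}⟩` for a linear map `δ : a ↦ a_{(-1)} ⊗ a_{(0)}`. -/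
noncomputable def contractCoaction {M : Type u} [AddCommGroup M] [Module k M]
    (δ : M →ₗ[k] H ⊗[k] M) (f : Module.Dual k M) : M →ₗ[k] H :=
  (TensorProduct.rid k H).toLinearMap ∘ₗ f.lTensor H ∘ₗ δ

variable {k H} in
/-- The map `a ↦ a ↼ α = ⟨α, a_{(-1)}⟩ a_{(0)}` for a linear map `δ : a ↦ a_{(-1)} ⊗ a_{(0)}`. -/
noncomputable def harpoon {M : Type u} [AddCommGroup M] [Module k M]
    (δ : M →ₗ[k] H ⊗[k] M) (α : Module.Dual k H) : M →ₗ[k] M :=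
  (TensorProduct.lid k M).toLinearMap ∘ₗ α.rTensor M ∘ₗ δ

variable {k H} in
/-- `l` is a `g`-cointegral on the comodule algebra `A`: `a_{(-1)} ⟨l, a_{(0)}⟩ = l(a) g`. -/
def IsGCointegral [LeftComoduleAlgebra k H A] (g : GroupLike k H) (l : Module.Dual k A) : Prop :=
  ∀ a : A, contractCoaction (LeftComoduleAlgebra.coaction (H := H)).toLinearMap l a = l a • (g : H)

variable {k H} in
/-- `l` is a right cointegral on `H`: `l(h_{(1)}) h_{(2)} = l(h) 1`. -/
def IsRightCointegral (l : Module.Dual k H) : Prop :=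
  ∀ h : H, harpoon (Coalgebra.comul (R := k) (A := H)) l h = l h • (1 : H)

variable {k H} in
/-- `Λ` is a left integral in `H`: `h Λ = ε(h) Λ`. -/
def IsLeftIntegral (L : H) : Prop :=
  ∀ h : H, h * L = Coalgebra.counit (R := k) h • L

end Comodule

/-! ### Frobenius traces and Nakayama automorphisms -/

section Frobenius

variable {k A : Type u} [Field k] [Ring A] [Algebra k A]

/-- The map `A → A^*`, `a ↦ l(a -)`. -/
def traceMap (l : Module.Dual k A) : A →ₗ[k] Module.Dual k A :=
  (LinearMap.mul k A).compr₂ l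

/-- `l` is a Frobenius trace on `A`: the map `A → A^*`, `a ↦ l(a -)`, is bijective. -/
def IsFrobeniusTrace (l : Module.Dual k A) : Prop :=
  Function.Bijective (traceMap l)

theorem IsFrobeniusTrace.flip_bijective [FiniteDimensional k A] {l : Module.Dual k A}
    (hl : IsFrobeniusTrace l) : Function.Bijective (traceMap l).flip := by
  have hinj : Function.Injective (traceMap l).flip := by
    rw [injective_iff_map_eq_zero]
    intro a ha
    rw [← Module.forall_dual_apply_eq_zero_iff k a]
    intro f
    obtain ⟨b, rfl⟩ := hl.2 f
    exact LinearMap.congr_fun ha b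
  exact ⟨hinj, (LinearMap.injective_iff_surjective_of_finrank_eq_finrank
    Subspace.dual_finrank_eq.symm).1 hinj⟩

/-- The Nakayama automorphism `ν` of `A` associated to a Frobenius trace `l`, that is, the unique
map such that `l(b a) = l(ν(a) b)` for all `a`, `b`. -/
noncomputable def nakayamaAut [FiniteDimensional k A] {l : Module.Dual k A}
    (hl : IsFrobeniusTrace l) : A ≃ₗ[k] A :=
  (LinearEquiv.ofBijective _ hl.flip_bijective).trans (LinearEquiv.ofBijective _ hl).symm

theorem nakayamaAut_spec [FiniteDimensional k A] {l : Module.Dual k A}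
    (hl : IsFrobeniusTrace l) (a b : A) : l (b * a) = l (nakayamaAut hl a * b) := by
  have h : traceMap l (nakayamaAut hl a) = (traceMap l).flip a :=
    (LinearEquiv.ofBijective _ hl).apply_symm_apply _
  exact (LinearMap.congr_fun h b).symm

end Frobenius

/-! ### Relative Hopf bimodules -/

section RelHopfBimod

variable (k H A B : Type u) [Field k] [Ring H] [HopfAlgebra k H]
  [Ring A] [Algebra k A] [Ring B] [Algebra k B]

/-- A finite-dimensional vector space with a linear map `m ↦ m_{(-1)} ⊗ m_{(0)}` to `H ⊗ M` and
bilinear maps `lact a m = a · m` and `ract m b = m · b`, no axioms imposed. -/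
structure RelHopfBimodData where
  carrier : Type u
  [addCommGroup : AddCommGroup carrier]
  [module : Module k carrier]
  [finite : FiniteDimensional k carrier]
  coact : carrier →ₗ[k] H ⊗[k] carrier
  lact : A →ₗ[k] carrier →ₗ[k] carrier
  ract : carrier →ₗ[k] B →ₗ[k] carrier

attribute [instance] RelHopfBimodData.addCommGroup RelHopfBimodData.module
  RelHopfBimodData.finite

variable {k H A B}
variable [LeftComoduleAlgebra k H A] [LeftComoduleAlgebra k H B]

/-- The axioms of a bimodule over the algebras `A` and `B` in the category of left `H`-comodules:
`M` is an `A`-`B`-bimodule and a left `H`-comodule with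
`(a m)_{(-1)} ⊗ (a m)_{(0)} = a_{(-1)} m_{(-1)} ⊗ a_{(0)} m_{(0)}` and
`(m b)_{(-1)} ⊗ (m b)_{(0)} = m_{(-1)} b_{(-1)} ⊗ m_{(0)} b_{(0)}`. -/
structure IsRelHopfBimod (M : RelHopfBimodData k H A B) : Prop where
  isLeftCoaction : IsLeftCoaction M.coact
  one_lact : ∀ m, M.lact 1 m = m
  mul_lact : ∀ a a' m, M.lact (a * a') m = M.lact a (M.lact a' m)
  ract_one : ∀ m, M.ract m 1 = m
  ract_mul : ∀ m b b', M.ract m (b * b') = M.ract (M.ract m b) b'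
  lact_ract : ∀ a m b, M.ract (M.lact a m) b = M.lact a (M.ract m b)
  coact_lact : ∀ a m, M.coact (M.lact a m) =
    TensorProduct.map₂ (LinearMap.mul k H) M.lact
      (LeftComoduleAlgebra.coaction (k := k) (H := H) a) (M.coact m)
  coact_ract : ∀ m b, M.coact (M.ract m b) =
    TensorProduct.map₂ (LinearMap.mul k H) M.ract
      (M.coact m) (LeftComoduleAlgebra.coaction (k := k) (H := H) b)

variable (k H A B) in
/-- Finite-dimensional relative Hopf bimodules, the objects of `_A C_B`. -/
structure RelHopfBimod where
  toData : RelHopfBimodData k H A B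
  isRelHopfBimod : IsRelHopfBimod toData

/-- The space of morphisms: linear maps that commute with the coactions and the actions. -/
def RelHopfBimod.homSubmodule (M N : RelHopfBimod k H A B) :
    Submodule k (M.toData.carrier →ₗ[k] N.toData.carrier) where
  carrier := {f | (∀ m, N.toData.coact (f m) = f.lTensor H (M.toData.coact m)) ∧
    (∀ a m, f (M.toData.lact a m) = N.toData.lact a (f m)) ∧
    (∀ m b, f (M.toData.ract m b) = N.toData.ract (f m) b)}
  zero_mem' := by simp
  add_mem' := by
    rintro f g ⟨hf1, hf2, hf3⟩ ⟨hg1, hg2, hg3⟩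
    simp [LinearMap.lTensor_add, hf1, hf2, hf3, hg1, hg2, hg3]
  smul_mem' := by
    rintro c f ⟨hf1, hf2, hf3⟩
    simp [LinearMap.lTensor_smul, hf1, hf2, hf3]

instance : Category.{u} (RelHopfBimod k H A B) where
  Hom M N := M.homSubmodule N
  id M := ⟨LinearMap.id, by simp [RelHopfBimod.homSubmodule]⟩
  comp f g := ⟨g.1 ∘ₗ f.1, by
    obtain ⟨f, hf1, hf2, hf3⟩ := f
    obtain ⟨g, hg1, hg2, hg3⟩ := g
    refine ⟨fun m => ?_, fun a m => ?_, fun m b => ?_⟩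
    · rw [LinearMap.lTensor_comp, LinearMap.comp_apply, LinearMap.comp_apply, ← hf1, ← hg1]
    · rw [LinearMap.comp_apply, LinearMap.comp_apply, hf2, hg2]
    · rw [LinearMap.comp_apply, LinearMap.comp_apply, hf3, hg3]⟩

instance : Preadditive (RelHopfBimod k H A B) where
  homGroup M N := inferInstanceAs (AddCommGroup (M.homSubmodule N))
  add_comp _ _ _ f f' g := Subtype.ext (LinearMap.comp_add f.1 f'.1 g.1)
  comp_add _ _ _ f g g' := Subtype.ext (LinearMap.add_comp f.1 g'.1 g.1)

instance : Linear k (RelHopfBimod k H A B) where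
  homModule M N := inferInstanceAs (Module k (M.homSubmodule N))
  smul_comp _ _ _ c f g := Subtype.ext (LinearMap.comp_smul g.1 c f.1)
  comp_smul _ _ _ f c g := Subtype.ext (LinearMap.smul_comp c g.1 f.1)

instance : HomFinite k (RelHopfBimod k H A B) where
  finite M N := inferInstanceAs (Module.Finite k (M.homSubmodule N))

/-- The map `h ↦ g_A⁻¹ S²(h) g_B⁻¹ g_H` on `H`. -/
noncomputable def coactionTwist (gA gB : GroupLike k H) (gH : H) : H →ₗ[k] H :=
  LinearMap.mulLeft k ((gA⁻¹ : GroupLike k H) : H) ∘ₗ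
    LinearMap.mulRight k (((gB⁻¹ : GroupLike k H) : H) * gH) ∘ₗ
      HopfAlgebra.antipode k ∘ₗ HopfAlgebra.antipode k

/-- The vector space `M` with the coaction `m ↦ g_A⁻¹ S²(m_{(-1)}) g_B⁻¹ g_H ⊗ m_{(0)}` and the
actions `a ▷ m ◁ b = ν_A(a) · m · ν_B⁻¹(b ↼ α_H)`. -/
noncomputable def nakayamaTwist (gA gB : GroupLike k H) (gH : H) (αH : Module.Dual k H)
    (νA : A ≃ₗ[k] A) (νB : B ≃ₗ[k] B) (M : RelHopfBimodData k H A B) :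
    RelHopfBimodData k H A B where
  carrier := M.carrier
  coact := (coactionTwist gA gB gH).rTensor M.carrier ∘ₗ M.coact
  lact := M.lact ∘ₗ νA.toLinearMap
  ract := M.ract.compl₂ (νB.symm.toLinearMap ∘ₗ
    harpoon (LeftComoduleAlgebra.coaction (k := k) (H := H) (A := B)).toLinearMap αH)

/-- The endofunctor of `_A C_B` given by `nakayamaTwist` on objects and by the identity on the
underlying linear maps, once the twisted data are known to be relative Hopf bimodules. -/
noncomputable def nakayamaTwistFunctor (gA gB : GroupLike k H) (gH : H) (αH : Module.Dual k H)
    (νA : A ≃ₗ[k] A) (νB : B ≃ₗ[k] B)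
    (h : ∀ M : RelHopfBimod k H A B,
      IsRelHopfBimod (nakayamaTwist gA gB gH αH νA νB M.toData)) :
    RelHopfBimod k H A B ⥤ RelHopfBimod k H A B where
  obj M := ⟨nakayamaTwist gA gB gH αH νA νB M.toData, h M⟩
  map {M N} f := ⟨f.1, by
    obtain ⟨f, hf1, hf2, hf3⟩ := f
    refine ⟨fun (m : M.toData.carrier) => ?_, fun a m => hf2 (νA a) m, fun m b => hf3 m _⟩
    change (coactionTwist gA gB gH).rTensor _ (N.toData.coact (f m)) =
      f.lTensor H ((coactionTwist gA gB gH).rTensor _ (M.toData.coact m))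
    rw [hf1]
    exact LinearMap.congr_fun ((LinearMap.rTensor_comp_lTensor ..).trans
      (LinearMap.lTensor_comp_rTensor ..).symm) (M.toData.coact m)⟩

end RelHopfBimod

/-! The category behaves like the modules over a Frobenius algebra. It has an object G that is free
on one generator, so that Hom(G, X) is the underlying space of X, and also cofree on one linear
form, so that Hom(M, G) is the dual of M. This is what `FrobeniusGenerator` records. Given such a G,
a vector x of X and a form ξ on M yield a composite M → G → X, and transposing the resulting map X ⊗
M^* → Hom(M, X) gives X ⊗ Hom(M, X)^* → M. These maps form a universal cowedge on vector spaces: by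
the cowedge relation every component is determined by the component at G on the generator, where
Hom(M, G)^* is M^** = M.

It remains to find the structure on M for which these maps are morphisms. A vector y of G defines
the endomorphism of G that sends the generator to y. Under the form, this endomorphism can be
replaced by a structure operator D of G, and D commutes with all morphisms M → G once its
counterpart E on M is used. Taking y to be a translate of the generator under one of the actions or
the coaction yields the twisted structure (`IsTwistedBy`, `cowedgeMap_apply_tmul`). The axioms for
the twisted structure need no computation: the morphisms from G span the target, so the axioms are
inherited (`IsRelHopfBimod.of_span`).

The object G is H ⊗ V, with V the bilinear forms on A × B. Cofreeness is formal. Freeness has two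
ingredients. First, a ⊗ h ⊗ b ↦ a (h ⊗ (λ_A ⊗ λ_B)) b identifies A ⊗ H ⊗ B with G, because the
traces are non-degenerate and the antipode S of H is bijective (`cofreeOrbit_bijective`). Second, a
vector x of a comodule gives the colinear map h ↦ λ_H(S(h) x_{(-1)}) x_{(0)}, and an integral p
normalized by λ_H(S(p) -) = ε recovers x at h = p (`coaction_cointegralOrbit`,
`exists_isLeftIntegral`). The generator is p ⊗ (λ_A ⊗ λ_B). The three twists are then read off from
`cofreeForm_fromCofree`: the Nakayama automorphisms come from the traces, α_H from p h = α_H(h) p,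
and S² with g_H from p_{(1)} λ_H(S(h) p_{(2)}) = S²(h) g_H. -/

/-! ### Tensors expanded along a basis of one factor -/

section TensorDual

variable {k H M : Type*} [Field k] [AddCommGroup H] [Module k H] [AddCommGroup M] [Module k M]

theorem TensorProduct.eq_sum_basis_tmul_left {ι : Type*} [Fintype ι] (e : Module.Basis ι k H)
    (t : H ⊗[k] M) :
    t = ∑ i, e i ⊗ₜ TensorProduct.lid k M ((e.coord i).rTensor M t) := by
  induction t with
  | zero => simp
  | add x y hx hy =>
    simp only [map_add, TensorProduct.tmul_add, Finset.sum_add_distrib]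
    rw [← hx, ← hy]
  | tmul h m =>
    simp only [LinearMap.rTensor_tmul, TensorProduct.lid_tmul, ← TensorProduct.smul_tmul,
      ← TensorProduct.sum_tmul, Module.Basis.coord_apply, e.sum_repr]

theorem TensorProduct.ext_dual_left [FiniteDimensional k H] {s t : H ⊗[k] M}
    (h : ∀ χ : Module.Dual k H, TensorProduct.lid k M (χ.rTensor M s) =
      TensorProduct.lid k M (χ.rTensor M t)) : s = t := by
  rw [TensorProduct.eq_sum_basis_tmul_left (Module.finBasis k H) s,
    TensorProduct.eq_sum_basis_tmul_left (Module.finBasis k H) t]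
  simp only [h]

theorem TensorProduct.eq_sum_tmul_basis_right {ι : Type*} [Fintype ι] (e : Module.Basis ι k M)
    (t : H ⊗[k] M) :
    t = ∑ i, TensorProduct.rid k H ((e.coord i).lTensor H t) ⊗ₜ e i := by
  induction t with
  | zero => simp
  | add x y hx hy =>
    simp only [map_add, TensorProduct.add_tmul, Finset.sum_add_distrib]
    rw [← hx, ← hy]
  | tmul h m =>
    simp only [LinearMap.lTensor_tmul, TensorProduct.rid_tmul, TensorProduct.smul_tmul,
      ← TensorProduct.tmul_sum, Module.Basis.coord_apply, e.sum_repr]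

theorem TensorProduct.sum_tmul_basis_injective {ι : Type*} [Fintype ι] (e : Module.Basis ι k M)
    {x y : ι → H} (h : ∑ i, x i ⊗ₜ[k] e i = ∑ i, y i ⊗ₜ[k] e i) : x = y := by
  classical
  funext j
  simpa [Finsupp.single_apply] using
    congrArg (fun t => TensorProduct.rid k H ((e.coord j).lTensor H t)) h

end TensorDual

/-! ### Matrix coefficients of a coaction, in place of Sweedler notation -/

section MatrixCoefficients

variable {k H : Type u} [Field k] [Ring H] [HopfAlgebra k H]
  {M : Type u} [AddCommGroup M] [Module k M] {ι : Type*} [Fintype ι]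

/-- The matrix coefficients of a coaction `δ` with respect to a basis. -/
noncomputable def matrixCoeff (δ : M →ₗ[k] H ⊗[k] M) (b : Module.Basis ι k M) (i j : ι) : H :=
  contractCoaction δ (b.coord j) (b i)

theorem coaction_basis (δ : M →ₗ[k] H ⊗[k] M) (b : Module.Basis ι k M) (i : ι) :
    δ (b i) = ∑ j, matrixCoeff δ b i j ⊗ₜ b j :=
  TensorProduct.eq_sum_tmul_basis_right b _

variable {δ : M →ₗ[k] H ⊗[k] M} (hδ : IsLeftCoaction δ) (b : Module.Basis ι k M)
include hδ

theorem IsLeftCoaction.comul_matrixCoeff (i j : ι) :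
    Coalgebra.comul (R := k) (matrixCoeff δ b i j) =
      ∑ l, matrixCoeff δ b i l ⊗ₜ matrixCoeff δ b l j := by
  have h := LinearMap.congr_fun hδ.coassoc (b i)
  have h2 := congrArg (TensorProduct.assoc k H H M).symm h
  simp only [LinearMap.comp_apply, LinearEquiv.coe_coe, LinearEquiv.symm_apply_apply,
    coaction_basis δ b, map_sum, LinearMap.rTensor_tmul, LinearMap.lTensor_tmul,
    TensorProduct.tmul_sum, TensorProduct.assoc_symm_tmul] at h2
  rw [Finset.sum_comm] at h2
  simp only [← TensorProduct.sum_tmul] at h2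
  exact congrFun (TensorProduct.sum_tmul_basis_injective b h2) j

theorem IsLeftCoaction.counit_matrixCoeff [DecidableEq ι] (i j : ι) :
    Coalgebra.counit (R := k) (matrixCoeff δ b i j) = if i = j then 1 else 0 := by
  have h := congrArg (b.coord j) (LinearMap.congr_fun hδ.counit (b i))
  simpa [coaction_basis δ b, Finsupp.single_apply] using h

theorem IsLeftCoaction.sum_antipode_mul_matrixCoeff [DecidableEq ι] (i j : ι) :
    ∑ l, HopfAlgebra.antipode k (matrixCoeff δ b i l) * matrixCoeff δ b l j =
      if i = j then 1 else 0 := by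
  have h := HopfAlgebra.mul_antipode_rTensor_comul_apply (R := k) (matrixCoeff δ b i j)
  simpa [hδ.comul_matrixCoeff b, hδ.counit_matrixCoeff b, apply_ite] using h

theorem IsLeftCoaction.sum_matrixCoeff_mul_antipode [DecidableEq ι] (i j : ι) :
    ∑ l, matrixCoeff δ b i l * HopfAlgebra.antipode k (matrixCoeff δ b l j) =
      if i = j then 1 else 0 := by
  have h := HopfAlgebra.mul_antipode_lTensor_comul_apply (R := k) (matrixCoeff δ b i j)
  simpa [hδ.comul_matrixCoeff b, hδ.counit_matrixCoeff b, apply_ite] using h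

/-- Uniqueness of inverses in matrices over H ⊗ H: the left side is a right inverse of the matrix of
the Δ(c i j), and the right side is a left inverse of it. -/
theorem IsLeftCoaction.comul_antipode_matrixCoeff (i j : ι) :
    Coalgebra.comul (R := k) (HopfAlgebra.antipode k (matrixCoeff δ b i j)) =
      ∑ l, HopfAlgebra.antipode k (matrixCoeff δ b l j) ⊗ₜ
        HopfAlgebra.antipode k (matrixCoeff δ b i l) := by
  classical
  let X : Matrix ι ι (H ⊗[k] H) := Matrix.of fun i j =>
    ∑ l, HopfAlgebra.antipode k (matrixCoeff δ b l j) ⊗ₜ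
        HopfAlgebra.antipode k (matrixCoeff δ b i l)
  let D : Matrix ι ι (H ⊗[k] H) := Matrix.of fun i j =>
    Coalgebra.comul (R := k) (matrixCoeff δ b i j)
  let Y : Matrix ι ι (H ⊗[k] H) := Matrix.of fun i j =>
    Coalgebra.comul (R := k) (HopfAlgebra.antipode k (matrixCoeff δ b i j))
  have hDY : D * Y = 1 := by
    ext i j
    simp only [D, Y, Matrix.mul_apply, Matrix.of_apply, ← Bialgebra.comul_mul, ← map_sum,
      hδ.sum_matrixCoeff_mul_antipode b, Matrix.one_apply]
    split_ifs <;> simp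
  have hXD : X * D = 1 := by
    ext i j
    simp only [D, X, Matrix.mul_apply, Matrix.of_apply, hδ.comul_matrixCoeff b,
      Finset.sum_mul_sum, Algebra.TensorProduct.tmul_mul_tmul]
    calc _ = ∑ x, ∑ y, (∑ l, HopfAlgebra.antipode k (matrixCoeff δ b x l) * matrixCoeff δ b l y) ⊗ₜ[k]
            (HopfAlgebra.antipode k (matrixCoeff δ b i x) * matrixCoeff δ b y j) := by
          simp only [TensorProduct.sum_tmul]
          rw [Finset.sum_comm]
          exact Finset.sum_congr rfl fun x _ => Finset.sum_comm
      _ = _ := by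
          simp only [hδ.sum_antipode_mul_matrixCoeff b, TensorProduct.ite_tmul, Matrix.one_apply,
            Finset.sum_ite_eq, Finset.mem_univ, if_true, ← TensorProduct.tmul_sum]
          split_ifs <;> simp [Algebra.TensorProduct.one_def]
  exact (congrArg (fun Z : Matrix ι ι (H ⊗[k] H) => Z i j) (left_inv_eq_right_inv hXD hDY)).symm

end MatrixCoefficients

/-! ### Matrix coefficients of H coacting on itself -/

section RegularCoaction

variable {k H : Type u} [Field k] [Ring H] [HopfAlgebra k H]

theorem isLeftCoaction_comul : IsLeftCoaction (Coalgebra.comul (R := k) (A := H)) where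
  coassoc := Coalgebra.coassoc
  counit := by ext; simp

variable {ι : Type*} [Fintype ι] (e : Module.Basis ι k H)

/-- The matrix coefficients of the regular coaction. -/
noncomputable abbrev regCoeff (i j : ι) : H := matrixCoeff (Coalgebra.comul (R := k)) e i j

theorem sum_counit_smul_regCoeff (i : ι) :
    ∑ j, Coalgebra.counit (R := k) (e j) • regCoeff e i j = e i := by
  have h := congrArg (TensorProduct.rid k H) (Coalgebra.lTensor_counit_comul (R := k) (e i))
  simpa [coaction_basis (Coalgebra.comul (R := k)) e] using h

theorem sum_regCoeff_mul_antipode (i : ι) :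
    ∑ j, regCoeff e i j * HopfAlgebra.antipode k (e j) = algebraMap k H (Coalgebra.counit (e i)) := by
  have h := HopfAlgebra.mul_antipode_lTensor_comul_apply (R := k) (e i)
  simpa [coaction_basis (Coalgebra.comul (R := k)) e] using h

theorem comul_antipode_basis (i : ι) :
    Coalgebra.comul (R := k) (HopfAlgebra.antipode k (e i)) =
      ∑ j, HopfAlgebra.antipode k (e j) ⊗ₜ HopfAlgebra.antipode k (regCoeff e i j) := by
  conv_lhs => rw [← sum_counit_smul_regCoeff e i]
  simp only [map_sum, map_smul, isLeftCoaction_comul.comul_antipode_matrixCoeff e]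
  simp only [Finset.smul_sum]
  rw [Finset.sum_comm]
  refine Finset.sum_congr rfl fun l _ => ?_
  conv_rhs => rw [← sum_counit_smul_regCoeff e l]
  simp only [map_sum, map_smul, TensorProduct.sum_tmul, TensorProduct.smul_tmul']

end RegularCoaction

/-! ### Contracting one tensor factor with a functional -/

section Contractions

variable {k H : Type*} [Field k] [Ring H] [Algebra k H] {M : Type*} [AddCommGroup M] [Module k M]

/-- The map `h ⊗ m ↦ φ(h) m`. -/
noncomputable def evalLeft (M : Type*) [AddCommGroup M] [Module k M] (φ : Module.Dual k H) :
    H ⊗[k] M →ₗ[k] M :=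
  (TensorProduct.lid k M).toLinearMap ∘ₗ φ.rTensor M

/-- The map `h ⊗ m ↦ φ(m) h`. -/
noncomputable def evalRight (H : Type*) [AddCommGroup H] [Module k H] (φ : Module.Dual k M) :
    H ⊗[k] M →ₗ[k] H :=
  (TensorProduct.rid k H).toLinearMap ∘ₗ φ.lTensor H

@[simp]
theorem evalLeft_tmul (φ : Module.Dual k H) (h : H) (m : M) :
    evalLeft M φ (h ⊗ₜ m) = φ h • m := by simp [evalLeft]

@[simp]
theorem evalRight_tmul (φ : Module.Dual k M) (h : H) (m : M) :
    evalRight H φ (h ⊗ₜ m) = φ m • h := by simp [evalRight]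

theorem evalLeft_tmul_mul (φ : Module.Dual k H) (h c : H) (w : H ⊗[k] H) :
    evalLeft H φ ((h ⊗ₜ c) * w) = c * evalLeft H (φ ∘ₗ LinearMap.mulLeft k h) w := by
  induction w with
  | zero => simp
  | add x y hx hy => rw [mul_add, map_add, map_add, hx, hy, mul_add]
  | tmul x y => simp

theorem evalRight_tmul_mul (φ : Module.Dual k H) (h c : H) (w : H ⊗[k] H) :
    evalRight H φ ((h ⊗ₜ c) * w) = h * evalRight H (φ ∘ₗ LinearMap.mulLeft k c) w := by
  induction w with
  | zero => simp
  | add x y hx hy => rw [mul_add, map_add, map_add, hx, hy, mul_add]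
  | tmul x y => simp

theorem evalLeft_sum_smul {ι : Type*} (s : Finset ι) (c : ι → k) (φ : ι → Module.Dual k H)
    (w : H ⊗[k] M) :
    evalLeft M (∑ i ∈ s, c i • φ i) w = ∑ i ∈ s, c i • evalLeft M (φ i) w := by
  induction w with
  | zero => simp
  | add x y hx hy => simp only [map_add, hx, hy, smul_add, Finset.sum_add_distrib]
  | tmul x y => simp [Finset.sum_smul, mul_smul]

theorem evalRight_sum_smul {ι : Type*} (s : Finset ι) (c : ι → k) (φ : ι → Module.Dual k M)
    (w : H ⊗[k] M) :
    evalRight H (∑ i ∈ s, c i • φ i) w = ∑ i ∈ s, c i • evalRight H (φ i) w := by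
  induction w with
  | zero => simp
  | add x y hx hy => simp only [map_add, hx, hy, smul_add, Finset.sum_add_distrib]
  | tmul x y => simp [Finset.sum_smul, mul_smul]

theorem evalLeft_lTensor {N : Type*} [AddCommGroup N] [Module k N] (φ : Module.Dual k H)
    (f : M →ₗ[k] N) (w : H ⊗[k] M) : evalLeft N φ (f.lTensor H w) = f (evalLeft M φ w) := by
  induction w with
  | zero => simp
  | add x y hx hy => simp only [map_add, hx, hy]
  | tmul x y => simp

theorem evalLeft_rTensor (φ : Module.Dual k H) (f : H →ₗ[k] H) (w : H ⊗[k] M) :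
    evalLeft M φ (f.rTensor M w) = evalLeft M (φ ∘ₗ f) w := by
  induction w with
  | zero => simp
  | add x y hx hy => simp only [map_add, hx, hy]
  | tmul x y => simp

end Contractions

/-! ### Integrals and bijectivity of the antipode, from a non-zero cointegral -/

section Integrals

open HopfAlgebra (antipode)
open Coalgebra (comul counit)

variable {k H : Type u} [Field k] [Ring H] [HopfAlgebra k H]

theorem harpoon_apply {M : Type u} [AddCommGroup M] [Module k M]
    (δ : M →ₗ[k] H ⊗[k] M) (α : Module.Dual k H) (m : M) :
    harpoon δ α m = evalLeft M α (δ m) := rfl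

theorem contractCoaction_apply {M : Type u} [AddCommGroup M] [Module k M]
    (δ : M →ₗ[k] H ⊗[k] M) (f : Module.Dual k M) (m : M) :
    contractCoaction δ f m = evalRight H f (δ m) := rfl

variable [FiniteDimensional k H] {l : Module.Dual k H}

/-- `p_{(1)} l(S(h) p_{(2)}) = S²(h) g` -/
theorem IsLeftIntegral.evalRight_comul_eq {p g : H} (hp : IsLeftIntegral (k := k) p)
    (hlp : l p = 1) (hg : ∀ h : H, contractCoaction (comul (R := k) (A := H)) l h = l h • g) (h : H) :
    evalRight H (l ∘ₗ LinearMap.mulLeft k (antipode k h)) (comul (R := k) p) =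
      antipode k (antipode k h) * g := by
  classical
  let e := Module.finBasis k H
  have key : ∀ i, evalRight H (l ∘ₗ LinearMap.mulLeft k (antipode k (e i))) (comul (R := k) p) =
      antipode k (antipode k (e i)) * g := by
    intro i
    -- The property of g at S(h) p, in Sweedler form: ε(h) g = S(h₂) p₁ l(S(h₁) p₂).
    have h1 : ∀ j, counit (R := k) (regCoeff e i j) • g = ∑ m, antipode k (regCoeff e m j) *
        evalRight H (l ∘ₗ LinearMap.mulLeft k (antipode k (regCoeff e i m))) (comul (R := k) p) := by
      intro j
      have h2 := hg (antipode k (regCoeff e i j) * p)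
      rw [contractCoaction_apply, Bialgebra.comul_mul,
        isLeftCoaction_comul.comul_antipode_matrixCoeff e, Finset.sum_mul, map_sum, hp] at h2
      simp only [evalRight_tmul_mul, map_smul, hlp, HopfAlgebra.counit_antipode] at h2
      simpa using h2.symm
    have h3 : l ∘ₗ LinearMap.mulLeft k (antipode k (e i)) = ∑ m, counit (R := k) (e m) •
        (l ∘ₗ LinearMap.mulLeft k (antipode k (regCoeff e i m))) := by
      ext x
      conv_lhs => rw [← sum_counit_smul_regCoeff e i]
      simp [Finset.sum_mul]
    rw [h3, evalRight_sum_smul]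
    -- The factor S(h₂) is cancelled by inserting S(h₂ S(h₃)) = S²(h₃) S(h₂).
    calc _ = ∑ m, antipode k (∑ j, regCoeff e m j * antipode k (e j)) *
          evalRight H (l ∘ₗ LinearMap.mulLeft k (antipode k (regCoeff e i m)))
            (comul (R := k) p) := by
          simp [sum_regCoeff_mul_antipode, Algebra.algebraMap_eq_smul_one]
      _ = ∑ j, antipode k (antipode k (e j)) * (counit (R := k) (regCoeff e i j) • g) := by
          simp only [h1, map_sum, HopfAlgebra.antipode_mul_antidistrib, Finset.sum_mul,
            Finset.mul_sum, mul_assoc]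
          exact Finset.sum_comm
      _ = _ := by simp [isLeftCoaction_comul.counit_matrixCoeff e]
  have hlin : l ∘ₗ LinearMap.mulLeft k (antipode k h) =
      ∑ i, e.repr h i • (l ∘ₗ LinearMap.mulLeft k (antipode k (e i))) := by
    refine (congrArg (traceMap l ∘ₗ antipode k) (e.sum_repr h)).symm.trans ?_
    simp only [map_sum, map_smul]
    rfl
  rw [hlin, evalRight_sum_smul]
  conv_rhs => rw [← e.sum_repr h]
  simp only [map_sum, map_smul, key, Finset.sum_mul, smul_mul_assoc]

variable (hl : IsRightCointegral l)
include hl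

/-- `l(S(h) y_{(1)}) y_{(2)} = h_{(1)} l(S(h_{(2)}) y)` -/
theorem IsRightCointegral.antipode_shift (h y : H) :
    evalLeft H (l ∘ₗ LinearMap.mulLeft k (antipode k h)) (comul (R := k) y) =
      evalRight H (l ∘ₗ LinearMap.mulRight k y ∘ₗ antipode k) (comul (R := k) h) := by
  classical
  let e := Module.finBasis k H
  have key : ∀ i, evalLeft H (l ∘ₗ LinearMap.mulLeft k (antipode k (e i))) (comul (R := k) y) =
      evalRight H (l ∘ₗ LinearMap.mulRight k y ∘ₗ antipode k) (comul (R := k) (e i)) := by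
    intro i
    -- The cointegral property at S(h) y: l(S(h) y) 1 = S(h₁) l(S(h₂) y₁) y₂. Multiplying by one
    -- more leg of h on the left cancels S(h₁).
    have h1 : ∀ j, (l (antipode k (e j) * y)) • (1 : H) =
        ∑ m, antipode k (regCoeff e j m) *
          evalLeft H (l ∘ₗ LinearMap.mulLeft k (antipode k (e m))) (comul (R := k) y) := by
      intro j
      rw [← hl, harpoon_apply, Bialgebra.comul_mul, comul_antipode_basis e, Finset.sum_mul,
        map_sum]
      simp only [evalLeft_tmul_mul]
    rw [coaction_basis (comul (R := k)) e i]
    simp only [map_sum, evalRight_tmul, LinearMap.comp_apply, LinearMap.mulRight_apply]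
    calc _ = ∑ m, (∑ j, regCoeff e i j * antipode k (regCoeff e j m)) *
          evalLeft H (l ∘ₗ LinearMap.mulLeft k (antipode k (e m))) (comul (R := k) y) := by
          simp [isLeftCoaction_comul.sum_matrixCoeff_mul_antipode e]
      _ = ∑ j, regCoeff e i j * (l (antipode k (e j) * y) • (1 : H)) := by
          simp only [h1, Finset.sum_mul, Finset.mul_sum, mul_assoc]
          exact Finset.sum_comm
      _ = _ := by simp
  have hlin : l ∘ₗ LinearMap.mulLeft k (antipode k h) =
      ∑ i, e.repr h i • (l ∘ₗ LinearMap.mulLeft k (antipode k (e i))) := by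
    refine (congrArg (traceMap l ∘ₗ antipode k) (e.sum_repr h)).symm.trans ?_
    simp only [map_sum, map_smul]
    rfl
  rw [hlin, evalLeft_sum_smul]
  conv_rhs => rw [← e.sum_repr h]
  simp only [map_sum, map_smul, key]

/-- The kernel K of h ↦ l(S(h) -) is a left ideal, and the shift identity gives Δ(K) ⊆ H ⊗ K. Since
1 ∉ K, these force ε = 0 on K, so n = n₁ ε(n₂) = 0 for n in K. -/
theorem IsRightCointegral.eq_zero_of_antipode_mul (hl0 : l ≠ 0) {h : H}
    (hh : ∀ y, l (antipode k h * y) = 0) : h = 0 := by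
  let f : H →ₗ[k] Module.Dual k H := traceMap l ∘ₗ antipode k
  have hf : ∀ x y, f x y = l (antipode k x * y) := fun _ _ => rfl
  have hone : (1 : H) ∉ LinearMap.ker f := fun h1 => hl0 <| by
    ext y
    simpa [hf] using LinearMap.congr_fun (LinearMap.mem_ker.1 h1) y
  have hideal : ∀ x n, n ∈ LinearMap.ker f → x * n ∈ LinearMap.ker f := by
    intro x n hn
    ext y
    simpa [hf, HopfAlgebra.antipode_mul_antidistrib, mul_assoc] using
      LinearMap.congr_fun (LinearMap.mem_ker.1 hn) (antipode k x * y)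
  let e := Module.finBasis k H
  let r : H → Fin (Module.finrank k H) → H := fun n i =>
    evalLeft H (e.coord i) (comul (R := k) n)
  have hr : ∀ n, comul (R := k) n = ∑ i, e i ⊗ₜ r n i := fun n =>
    TensorProduct.eq_sum_basis_tmul_left e _
  have hcoideal : ∀ n ∈ LinearMap.ker f, ∀ i, r n i ∈ LinearMap.ker f := by
    intro n hn i
    ext y
    have h1 := hl.antipode_shift n y
    have h2 : l ∘ₗ LinearMap.mulLeft k (antipode k n) = 0 := LinearMap.mem_ker.1 hn
    rw [h2, hr n] at h1
    have h3 := congrArg (fun t => e.repr t i) h1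
    simpa [Finsupp.single_apply, evalLeft, hf] using h3.symm
  -- Otherwise ε(n) 1 = S(n₁) n₂ would put 1 into the left ideal.
  have hcounit : ∀ n ∈ LinearMap.ker f, counit (R := k) n = 0 := by
    intro n hn
    by_contra hc
    apply hone
    have h1 := HopfAlgebra.mul_antipode_rTensor_comul_apply (R := k) n
    rw [hr] at h1
    simp only [map_sum, LinearMap.rTensor_tmul, LinearMap.mul'_apply, Algebra.algebraMap_eq_smul_one]
      at h1
    rw [← Submodule.smul_mem_iff _ hc, ← h1]
    exact Submodule.sum_mem _ fun i _ => hideal _ _ (hcoideal n hn i)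
  have h4 := congrArg (TensorProduct.rid k H) (Coalgebra.lTensor_counit_comul (R := k) h)
  rw [hr] at h4
  have h5 : h ∈ LinearMap.ker f := LinearMap.ext hh
  simpa [fun i => hcounit _ (hcoideal h h5 i)] using h4.symm

theorem IsRightCointegral.antipode_injective (hl0 : l ≠ 0) :
    Function.Injective (antipode k (A := H)) := by
  rw [injective_iff_map_eq_zero]
  exact fun h hh => hl.eq_zero_of_antipode_mul hl0 fun y => by simp [hh]

theorem IsRightCointegral.antipode_surjective (hl0 : l ≠ 0) :
    Function.Surjective (antipode k (A := H)) :=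
  LinearMap.injective_iff_surjective.1 (hl.antipode_injective hl0)

/-- A left integral that spans the space of left integrals, normalized by the cointegral. -/
theorem IsRightCointegral.exists_isLeftIntegral (hl0 : l ≠ 0) :
    ∃ p : H, IsLeftIntegral (k := k) p ∧ l p = 1 ∧
      ∀ y, l (antipode k p * y) = counit (R := k) y := by
  have hinj : Function.Injective (traceMap l ∘ₗ antipode k) := by
    rw [injective_iff_map_eq_zero]
    exact fun h hh => hl.eq_zero_of_antipode_mul hl0 (LinearMap.congr_fun hh)
  -- The witness is the preimage of ε under h ↦ l(S(h) -), which is onto by dimension.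
  obtain ⟨p, hp⟩ := (LinearMap.injective_iff_surjective_of_finrank_eq_finrank
    Subspace.dual_finrank_eq.symm).1 hinj (counit (R := k))
  have hp' : ∀ y, l (antipode k p * y) = counit (R := k) y := LinearMap.congr_fun hp
  have hint : IsLeftIntegral (k := k) p := by
    intro h
    apply hinj
    ext y
    simp [traceMap, HopfAlgebra.antipode_mul_antidistrib, mul_assoc, hp']
  refine ⟨p, hint, ?_, hp'⟩
  -- The two sides evaluate to p and l(p) p, which yields l(p) = 1 because p ≠ 0.
  have h1 := hl.antipode_shift p p
  have h2 : l ∘ₗ LinearMap.mulLeft k (antipode k p) = counit (R := k) := by ext y; simp [hp']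
  have h3 : l ∘ₗ LinearMap.mulRight k p ∘ₗ antipode k = l p • counit (R := k) := by
    ext h
    simp [hint (antipode k h), mul_comm]
  have h4 : evalLeft H (counit (R := k)) (comul (R := k) p) = p := by simp [evalLeft]
  have h5 : ∀ c : k, evalRight H (c • counit (R := k)) (comul (R := k) p) = c • p := by
    intro c
    simp [evalRight, LinearMap.lTensor_smul]
  rw [h2, h3, h4, h5] at h1
  have hp0 : p ≠ 0 := by
    rintro rfl
    have := hp' 1
    simp at this
  exact smul_left_injective k hp0 (by simpa using h1.symm)

/-- For every y, l(S(L) S(y)) = l(S(y L)) = ε(y) l(S(L)). As S is onto, L and l(S(L)) p define the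
same functional. -/
theorem IsRightCointegral.mul_integral_eq_smul (hl0 : l ≠ 0) {p L : H}
    (hp : ∀ y, l (antipode k p * y) = counit (R := k) y)
    (hL : IsLeftIntegral (k := k) L) : ∃ c : k, L = c • p := by
  refine ⟨l (antipode k L), sub_eq_zero.1 (hl.eq_zero_of_antipode_mul hl0 fun y => ?_)⟩
  obtain ⟨y, rfl⟩ := hl.antipode_surjective hl0 y
  rw [map_sub, map_smul, sub_mul, smul_mul_assoc, map_sub, map_smul, hp,
    ← HopfAlgebra.antipode_mul_antidistrib, hL y]
  simp [mul_comm]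

end Integrals

/-! ### Axioms inherited along spanning families of compatible maps -/

section Surjection

variable {k H A B : Type u} [Field k] [Ring H] [HopfAlgebra k H]
  [Ring A] [Algebra k A] [Ring B] [Algebra k B]

/-- Compatibility of a linear map with the structure maps of relative Hopf bimodule data. -/
structure IsRelHopfBimodHom (M N : RelHopfBimodData k H A B) (f : M.carrier →ₗ[k] N.carrier) :
    Prop where
  coact : ∀ m, N.coact (f m) = f.lTensor H (M.coact m)
  lact : ∀ a m, f (M.lact a m) = N.lact a (f m)
  ract : ∀ m b, f (M.ract m b) = N.ract (f m) b

variable [LeftComoduleAlgebra k H A] [LeftComoduleAlgebra k H B]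

theorem TensorProduct.map₂_lTensor_right {P Q Q' S T T' : Type*} [AddCommMonoid P] [Module k P]
    [AddCommMonoid Q] [Module k Q] [AddCommMonoid Q'] [Module k Q'] [AddCommMonoid S] [Module k S]
    [AddCommMonoid T] [Module k T] [AddCommMonoid T'] [Module k T']
    (m : P →ₗ[k] Q →ₗ[k] Q') (f : S →ₗ[k] T →ₗ[k] T') {U V : Type*}
    [AddCommMonoid U] [Module k U] [AddCommMonoid V] [Module k V]
    (g : S →ₗ[k] U →ₗ[k] V) (π : U →ₗ[k] T) (ρ : V →ₗ[k] T')
    (h : ∀ s x, ρ (g s x) = f s (π x)) (z : P ⊗[k] S) (w : Q ⊗[k] U) :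
    TensorProduct.map₂ m f z (π.lTensor Q w) = ρ.lTensor Q' (TensorProduct.map₂ m g z w) := by
  induction z with
  | zero => simp
  | add x y hx hy => simp only [map_add, LinearMap.add_apply, hx, hy]
  | tmul p s =>
    induction w with
    | zero => simp
    | add x y hx hy => simp only [map_add, hx, hy]
    | tmul q x => simp [h]

theorem TensorProduct.map₂_lTensor_left {P Q Q' S T T' : Type*} [AddCommMonoid P] [Module k P]
    [AddCommMonoid Q] [Module k Q] [AddCommMonoid Q'] [Module k Q'] [AddCommMonoid S] [Module k S]
    [AddCommMonoid T] [Module k T] [AddCommMonoid T'] [Module k T']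
    (m : Q →ₗ[k] P →ₗ[k] Q') (f : T →ₗ[k] S →ₗ[k] T') {U V : Type*}
    [AddCommMonoid U] [Module k U] [AddCommMonoid V] [Module k V]
    (g : U →ₗ[k] S →ₗ[k] V) (π : U →ₗ[k] T) (ρ : V →ₗ[k] T')
    (h : ∀ s x, ρ (g x s) = f (π x) s) (z : P ⊗[k] S) (w : Q ⊗[k] U) :
    TensorProduct.map₂ m f (π.lTensor Q w) z = ρ.lTensor Q' (TensorProduct.map₂ m g w z) := by
  induction z with
  | zero => simp
  | add x y hx hy => simp only [map_add, hx, hy]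
  | tmul p s =>
    induction w with
    | zero => simp
    | add x y hx hy => simp only [map_add, LinearMap.add_apply, hx, hy]
    | tmul q x => simp [h]

theorem IsLeftCoaction.of_span {M N : Type u} [AddCommGroup M] [Module k M]
    [AddCommGroup N] [Module k N] {δ : M →ₗ[k] H ⊗[k] M} {δ' : N →ₗ[k] H ⊗[k] N}
    (hδ : IsLeftCoaction δ) {ι : Type*} {f : ι → M →ₗ[k] N}
    (hs : Submodule.span k {n | ∃ i m, f i m = n} = ⊤)
    (h : ∀ i m, δ' (f i m) = (f i).lTensor H (δ m)) : IsLeftCoaction δ' where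
  coassoc := by
    refine LinearMap.ext_on hs ?_
    rintro n ⟨i, m, rfl⟩
    replace h := h i
    generalize f i = f at *
    have h1 := congrArg ((f.lTensor H).lTensor H) (LinearMap.congr_fun hδ.coassoc m)
    simp only [LinearMap.comp_apply, LinearEquiv.coe_coe, h] at h1 ⊢
    have h2 : ∀ w : H ⊗[k] M, (f.lTensor H).lTensor H (TensorProduct.assoc k H H M
        ((Coalgebra.comul (R := k) (A := H)).rTensor M w)) = TensorProduct.assoc k H H N
          ((Coalgebra.comul (R := k) (A := H)).rTensor N (f.lTensor H w)) := by
      intro w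
      induction w with
      | zero => simp
      | add x y hx hy => simp only [map_add, hx, hy]
      | tmul x m =>
        simp only [LinearMap.rTensor_tmul, LinearMap.lTensor_tmul]
        induction Coalgebra.comul (R := k) x with
        | zero => simp
        | add x y hx hy => simp only [TensorProduct.add_tmul, map_add, hx, hy]
        | tmul x y => simp
    have h3 : ∀ w : H ⊗[k] M, (f.lTensor H).lTensor H (δ.lTensor H w) =
        δ'.lTensor H (f.lTensor H w) := by
      intro w
      induction w with
      | zero => simp
      | add x y hx hy => simp only [map_add, hx, hy]
      | tmul x m => simp [h]
    rw [← h2, h1, h3]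
  counit := by
    refine LinearMap.ext_on hs ?_
    rintro n ⟨i, m, rfl⟩
    replace h := h i
    generalize f i = f at *
    have h1 := congrArg f (LinearMap.congr_fun hδ.counit m)
    simp only [LinearMap.comp_apply, LinearEquiv.coe_coe, h, LinearMap.id_apply] at h1 ⊢
    conv_rhs => rw [← h1]
    generalize δ m = w
    induction w with
    | zero => simp
    | add x y hx hy => simp only [map_add, hx, hy]
    | tmul x m => simp

/-- Each axiom is an equality of maps linear in n, so it can be tested on the images of the `f i`,
where it is transported from M. This spares any direct computation with the twisted structure maps.
-/
theorem IsRelHopfBimod.of_span {M N : RelHopfBimodData k H A B} (hM : IsRelHopfBimod M)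
    {ι : Type*} {f : ι → M.carrier →ₗ[k] N.carrier} (hf : ∀ i, IsRelHopfBimodHom M N (f i))
    (hs : Submodule.span k {n | ∃ i m, f i m = n} = ⊤) : IsRelHopfBimod N where
  isLeftCoaction := hM.isLeftCoaction.of_span hs fun i => (hf i).coact
  one_lact n := by
    refine LinearMap.congr_fun (f := N.lact 1) (g := LinearMap.id) (LinearMap.ext_on hs ?_) n
    rintro n ⟨i, m, rfl⟩
    simp [← (hf i).lact, hM.one_lact]
  mul_lact a a' n := by
    refine LinearMap.congr_fun (f := N.lact (a * a')) (g := N.lact a ∘ₗ N.lact a')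
      (LinearMap.ext_on hs ?_) n
    rintro n ⟨i, m, rfl⟩
    simp [← (hf i).lact, hM.mul_lact]
  ract_one n := by
    refine LinearMap.congr_fun (f := N.ract.flip 1) (g := LinearMap.id) (LinearMap.ext_on hs ?_) n
    rintro n ⟨i, m, rfl⟩
    simp [← (hf i).ract, hM.ract_one]
  ract_mul n b b' := by
    refine LinearMap.congr_fun (f := N.ract.flip (b * b')) (g := N.ract.flip b' ∘ₗ N.ract.flip b)
      (LinearMap.ext_on hs ?_) n
    rintro n ⟨i, m, rfl⟩
    simp [← (hf i).ract, hM.ract_mul]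
  lact_ract a n b := by
    refine LinearMap.congr_fun (f := N.ract.flip b ∘ₗ N.lact a) (g := N.lact a ∘ₗ N.ract.flip b)
      (LinearMap.ext_on hs ?_) n
    rintro n ⟨i, m, rfl⟩
    simp [← (hf i).ract, ← (hf i).lact, hM.lact_ract]
  coact_lact a n := by
    refine LinearMap.congr_fun (f := N.coact ∘ₗ N.lact a) (g := TensorProduct.map₂ _ _ _ ∘ₗ N.coact)
      (LinearMap.ext_on hs ?_) n
    rintro n ⟨i, m, rfl⟩
    rw [LinearMap.comp_apply, LinearMap.comp_apply, ← (hf i).lact, (hf i).coact, (hf i).coact,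
      hM.coact_lact]
    exact (TensorProduct.map₂_lTensor_right _ _ _ (f i) (f i) (hf i).lact _ _).symm
  coact_ract n b := by
    refine LinearMap.congr_fun (f := N.coact ∘ₗ N.ract.flip b)
      (g := (TensorProduct.map₂ _ _).flip _ ∘ₗ N.coact) (LinearMap.ext_on hs ?_) n
    rintro n ⟨i, m, rfl⟩
    rw [LinearMap.comp_apply, LinearMap.comp_apply, LinearMap.flip_apply, LinearMap.flip_apply,
      ← (hf i).ract, (hf i).coact, (hf i).coact, hM.coact_ract]
    exact (TensorProduct.map₂_lTensor_left _ _ _ (f i) (f i) (fun b m => (hf i).ract m b) _ _).symm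

end Surjection

/-! ### Copowers as tensor products with vector spaces -/

section Copower

variable {k H A B : Type u} [Field k] [Ring H] [HopfAlgebra k H]
  [Ring A] [Algebra k A] [Ring B] [Algebra k B]

theorem IsRelHopfBimodHom.comp {X Y Z : RelHopfBimodData k H A B} {f : X.carrier →ₗ[k] Y.carrier}
    {g : Y.carrier →ₗ[k] Z.carrier} (hg : IsRelHopfBimodHom Y Z g) (hf : IsRelHopfBimodHom X Y f) :
    IsRelHopfBimodHom X Z (g ∘ₗ f) where
  coact m := by simp [LinearMap.lTensor_comp, hg.coact, hf.coact]
  lact a m := by simp [hg.lact, hf.lact]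
  ract m b := by simp [hg.ract, hf.ract]

/-- A linear map is compatible with the structure maps if it is so after precomposition with
enough compatible maps. -/
theorem IsRelHopfBimodHom.of_lift {X Y Z : RelHopfBimodData k H A B}
    {g : Y.carrier →ₗ[k] Z.carrier}
    (h : ∀ y, ∃ (f : X.carrier →ₗ[k] Y.carrier) (x : X.carrier), f x = y ∧
      IsRelHopfBimodHom X Y f ∧ IsRelHopfBimodHom X Z (g ∘ₗ f)) :
    IsRelHopfBimodHom Y Z g where
  coact y := by
    obtain ⟨f, x, rfl, hf, hg⟩ := h y
    simpa [hf.coact, LinearMap.lTensor_comp] using hg.coact x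
  lact a y := by
    obtain ⟨f, x, rfl, hf, hg⟩ := h y
    simpa [hf.lact] using hg.lact a x
  ract y b := by
    obtain ⟨f, x, rfl, hf, hg⟩ := h y
    simpa [hf.ract] using hg.ract x b

/-- The structure maps on the tensor product `X ⊗ V` with a vector space `V`. -/
noncomputable def RelHopfBimodData.copower (X : RelHopfBimodData k H A B) (V : Type u)
    [AddCommGroup V] [Module k V] [FiniteDimensional k V] : RelHopfBimodData k H A B where
  carrier := X.carrier ⊗[k] V
  coact := (TensorProduct.assoc k H X.carrier V).toLinearMap ∘ₗ X.coact.rTensor V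
  lact := LinearMap.rTensorHom V ∘ₗ X.lact
  ract := (LinearMap.rTensorHom V ∘ₗ X.ract.flip).flip

variable {V : Type u} [AddCommGroup V] [Module k V] [FiniteDimensional k V]

theorem RelHopfBimodData.copower_coact_tmul (X : RelHopfBimodData k H A B) (x : X.carrier) (v : V) :
    (X.copower V).coact (x ⊗ₜ v) = ((TensorProduct.mk k X.carrier V).flip v).lTensor H (X.coact x) := by
  change TensorProduct.assoc k H X.carrier V (X.coact x ⊗ₜ v) = _
  generalize X.coact x = w
  induction w with
  | zero => simp
  | add x y hx hy => simp only [TensorProduct.add_tmul, map_add, hx, hy]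
  | tmul x m => simp

theorem RelHopfBimodData.isRelHopfBimodHom_mk (X : RelHopfBimodData k H A B) (v : V) :
    IsRelHopfBimodHom X (X.copower V) ((TensorProduct.mk k X.carrier V).flip v) where
  coact x := X.copower_coact_tmul x v
  lact _ _ := rfl
  ract _ _ := rfl

variable [LeftComoduleAlgebra k H A] [LeftComoduleAlgebra k H B]

theorem IsRelHopfBimod.copower {X : RelHopfBimodData k H A B} (hX : IsRelHopfBimod X) :
    IsRelHopfBimod (X.copower V) := by
  refine hX.of_span X.isRelHopfBimodHom_mk ?_
  refine Eq.trans ?_ (TensorProduct.span_tmul_eq_top k X.carrier V)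
  refine congrArg (Submodule.span k) (Set.ext fun t => ?_)
  exact exists_comm

end Copower

/-! ### The copower functor and its adjunction -/

section CopowerFunctor

variable {k H A B : Type u} [Field k] [Ring H] [HopfAlgebra k H]
  [Ring A] [Algebra k A] [Ring B] [Algebra k B]
  [LeftComoduleAlgebra k H A] [LeftComoduleAlgebra k H B]

namespace RelHopfBimod

variable {M N P : RelHopfBimod k H A B}

/-- The underlying linear map of a morphism. -/
def toLin : (M ⟶ N) →ₗ[k] (M.toData.carrier →ₗ[k] N.toData.carrier) :=
  (M.homSubmodule N).subtype

theorem toLin_injective : Function.Injective (toLin (M := M) (N := N)) := Subtype.val_injective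

theorem hom_ext {f g : M ⟶ N} (h : ∀ m, toLin f m = toLin g m) : f = g :=
  toLin_injective (LinearMap.ext h)

theorem isRelHopfBimodHom_toLin (f : M ⟶ N) : IsRelHopfBimodHom M.toData N.toData (toLin f) :=
  ⟨f.2.1, f.2.2.1, f.2.2.2⟩

/-- A morphism from a compatible linear map. -/
def homMk (f : M.toData.carrier →ₗ[k] N.toData.carrier)
    (hf : IsRelHopfBimodHom M.toData N.toData f) : M ⟶ N :=
  ⟨f, hf.coact, hf.lact, hf.ract⟩

@[simp]
theorem toLin_comp (f : M ⟶ N) (g : N ⟶ P) (m : M.toData.carrier) :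
    toLin (f ≫ g) m = toLin g (toLin f m) := rfl

@[simp]
theorem toLin_id (m : M.toData.carrier) : toLin (𝟙 M) m = m := rfl

theorem isRelHopfBimodHom_copower {V : Type u} [AddCommGroup V] [Module k V]
    [FiniteDimensional k V] {X Y : RelHopfBimodData k H A B}
    {f : X.carrier ⊗[k] V →ₗ[k] Y.carrier}
    (hf : ∀ v, IsRelHopfBimodHom X Y (f ∘ₗ (TensorProduct.mk k X.carrier V).flip v)) :
    IsRelHopfBimodHom (X.copower V) Y f where
  coact t := by
    refine LinearMap.congr_fun (f := Y.coact ∘ₗ f) (g := f.lTensor H ∘ₗ (X.copower V).coact) ?_ t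
    refine TensorProduct.ext' fun x v => ?_
    exact ((hf v).coact x).trans ((LinearMap.congr_fun (LinearMap.lTensor_comp H f _) _).trans
      (congrArg (f.lTensor H) (X.copower_coact_tmul x v).symm))
  lact a t := by
    refine LinearMap.congr_fun (f := f ∘ₗ (X.copower V).lact a) (g := Y.lact a ∘ₗ f) ?_ t
    exact TensorProduct.ext' fun x v => (hf v).lact a x
  ract t b := by
    refine LinearMap.congr_fun (f := f ∘ₗ (X.copower V).ract.flip b) (g := Y.ract.flip b ∘ₗ f) ?_ t
    exact TensorProduct.ext' fun x v => (hf v).ract x b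

/-- The copower `X ⊙ V = X ⊗ V`. -/
noncomputable abbrev copowerObj (X : RelHopfBimod k H A B) (V : Type u) [AddCommGroup V]
    [Module k V] [FiniteDimensional k V] : RelHopfBimod k H A B :=
  ⟨X.toData.copower V, X.isRelHopfBimod.copower⟩

section Hom

variable {V W : Type u} [AddCommGroup V] [Module k V] [FiniteDimensional k V]
  [AddCommGroup W] [Module k W] [FiniteDimensional k W]

/-- Morphisms `X ⊗ V ⟶ Y` are the same as linear maps `V → Hom(X, Y)`. -/
noncomputable def copowerHomEquiv (X : RelHopfBimod k H A B) (Y : RelHopfBimod k H A B) :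
    (X.copowerObj V ⟶ Y) ≃ (V →ₗ[k] (X ⟶ Y)) where
  toFun g :=
    { toFun := fun v => homMk (toLin g ∘ₗ (TensorProduct.mk k X.toData.carrier V).flip v)
        ((isRelHopfBimodHom_toLin g).comp (X.toData.isRelHopfBimodHom_mk v))
      map_add' := fun v w => hom_ext fun x =>
        (congrArg (toLin g) (TensorProduct.tmul_add x v w)).trans (map_add (toLin g) _ _)
      map_smul' := fun c v => hom_ext fun x =>
        (congrArg (toLin g) (TensorProduct.tmul_smul c x v)).trans (map_smul (toLin g) _ _) }
  invFun φ := homMk (TensorProduct.lift (toLin ∘ₗ φ).flip) <| isRelHopfBimodHom_copower fun v =>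
    isRelHopfBimodHom_toLin (φ v)
  left_inv _ := toLin_injective (TensorProduct.ext' fun _ _ => rfl)
  right_inv _ := LinearMap.ext fun _ => hom_ext fun _ => rfl

end Hom

variable (k H A B) in
/-- The copower bifunctor `(X, V) ↦ X ⊗ V`. -/
noncomputable def copowerFunctor :
    RelHopfBimod k H A B ⥤ FGModuleCat.{u} k ⥤ RelHopfBimod k H A B where
  obj X :=
    { obj := fun V => X.copowerObj V
      map := fun f => homMk (f.hom.hom.lTensor X.toData.carrier) <|
        isRelHopfBimodHom_copower fun v => X.toData.isRelHopfBimodHom_mk (f.hom.hom v)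
      map_id := fun _ => toLin_injective (TensorProduct.ext' fun _ _ => rfl)
      map_comp := fun _ _ => toLin_injective (TensorProduct.ext' fun _ _ => rfl) }
  map {X Y} f :=
    { app := fun V => homMk ((toLin f).rTensor V) <| isRelHopfBimodHom_copower fun v =>
        (Y.toData.isRelHopfBimodHom_mk (V := V) v).comp (isRelHopfBimodHom_toLin f)
      naturality := fun _ _ _ => toLin_injective (TensorProduct.ext' fun _ _ => rfl) }
  map_id X := by
    ext V
    exact toLin_injective (TensorProduct.ext' fun _ _ => rfl)
  map_comp f g := by
    ext V
    exact toLin_injective (TensorProduct.ext' fun _ _ => rfl)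

/-- The functor `X ⊗ -` is left adjoint to `Hom(X, -)`. -/
noncomputable def copowerAdj (X : RelHopfBimod k H A B) :
    (copowerFunctor k H A B).obj X ⊣ (homFunctor k (RelHopfBimod k H A B)).obj (op X) :=
  Adjunction.mkOfHomEquiv
    { homEquiv := fun V Y =>
        { toFun := fun g => FGModuleCat.ofHom (copowerHomEquiv X Y g)
          invFun := fun φ => (copowerHomEquiv X Y).symm φ.hom.hom
          left_inv := fun g => (copowerHomEquiv X Y).symm_apply_apply g
          right_inv := fun φ => FGModuleCat.hom_ext ((copowerHomEquiv X Y).apply_symm_apply φ.hom.hom) }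
      homEquiv_naturality_left_symm := fun _ _ =>
        toLin_injective (TensorProduct.ext' fun _ _ => rfl)
      homEquiv_naturality_right := fun _ _ =>
        FGModuleCat.hom_ext (LinearMap.ext fun _ => hom_ext fun _ => rfl) }

variable (k H A B) in
/-- The copower functors are left adjoint to the Hom functors, naturally in the object. -/
noncomputable def copowerAdj₂ :
    copowerFunctor k H A B ⊣₂ homFunctor k (RelHopfBimod k H A B) where
  adj := copowerAdj
  unit_whiskerRight_map f := by
    ext V v
    exact hom_ext fun _ => rfl

end RelHopfBimod

end CopowerFunctor

/-! ### The coend computed from an object that is both free and cofree -/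

section FrobeniusGenerator

variable (k H A B : Type u) [Field k] [Ring H] [HopfAlgebra k H]
  [Ring A] [Algebra k A] [Ring B] [Algebra k B]
  [LeftComoduleAlgebra k H A] [LeftComoduleAlgebra k H B]

open RelHopfBimod

/-- An object with an element that represents the forgetful functor to vector spaces, and a linear
form that represents the contravariant functor `M ↦ M^*`. -/
structure FrobeniusGenerator where
  obj : RelHopfBimod k H A B
  gen : obj.toData.carrier
  form : Module.Dual k obj.toData.carrier
  fromGen : ∀ X : RelHopfBimod k H A B, X.toData.carrier →ₗ[k] (obj ⟶ X)
  fromGen_gen : ∀ X (x : X.toData.carrier), toLin (fromGen X x) gen = x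
  hom_ext_gen : ∀ X (g g' : obj ⟶ X), toLin g gen = toLin g' gen → g = g'
  coform : ∀ M : RelHopfBimod k H A B, Module.Dual k M.toData.carrier →ₗ[k] (M ⟶ obj)
  form_coform : ∀ M (ξ : Module.Dual k M.toData.carrier) m, form (toLin (coform M ξ) m) = ξ m
  hom_ext_form : ∀ M (g g' : M ⟶ obj), (∀ m, form (toLin g m) = form (toLin g' m)) → g = g'

namespace FrobeniusGenerator

variable {k H A B} (G : FrobeniusGenerator k H A B) {M M' X X' : RelHopfBimod k H A B}

theorem fromGen_comp (f : X ⟶ X') (x : X.toData.carrier) :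
    G.fromGen X x ≫ f = G.fromGen X' (toLin f x) :=
  G.hom_ext_gen _ _ _ (by rw [toLin_comp, G.fromGen_gen, G.fromGen_gen])

theorem fromGen_gen_self : G.fromGen G.obj G.gen = 𝟙 G.obj :=
  G.hom_ext_gen _ _ _ (by rw [G.fromGen_gen, toLin_id])

theorem coform_comp (f : M ⟶ M') (ξ : Module.Dual k M'.toData.carrier) :
    f ≫ G.coform M' ξ = G.coform M (ξ ∘ₗ toLin f) :=
  G.hom_ext_form _ _ _ fun m => by rw [toLin_comp, G.form_coform, G.form_coform]; rfl

variable (M X) in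
/-- The rank one morphisms `M ⟶ X`. -/
noncomputable def rankOne :
    X.toData.carrier →ₗ[k] Module.Dual k M.toData.carrier →ₗ[k] (M ⟶ X) :=
  (CategoryTheory.Linear.comp M G.obj X ∘ₗ G.coform M).flip ∘ₗ G.fromGen X

theorem rankOne_apply (x : X.toData.carrier) (ξ : Module.Dual k M.toData.carrier) :
    G.rankOne M X x ξ = G.coform M ξ ≫ G.fromGen X x := rfl

variable (M X) in
/-- The components `X ⊗ Hom(M, X)^* → M` of the universal cowedge. -/
noncomputable def cowedgeMap :
    X.toData.carrier ⊗[k] Module.Dual k (M ⟶ X) →ₗ[k] M.toData.carrier :=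
  TensorProduct.lift (((LinearMap.llcomp k (Module.Dual k M.toData.carrier) (M ⟶ X) k).flip ∘ₗ
    G.rankOne M X).compr₂ (Module.evalEquiv k M.toData.carrier).symm.toLinearMap)

theorem apply_cowedgeMap (ξ : Module.Dual k M.toData.carrier) (x : X.toData.carrier)
    (φ : Module.Dual k (M ⟶ X)) :
    ξ (G.cowedgeMap M X (x ⊗ₜ φ)) = φ (G.coform M ξ ≫ G.fromGen X x) := by
  rw [← G.rankOne_apply]
  exact Module.apply_evalEquiv_symm_apply k M.toData.carrier ξ (φ ∘ₗ G.rankOne M X x)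

variable (M) in
/-- The functional `g ↦ form (g m)`. -/
noncomputable def homFunctional : M.toData.carrier →ₗ[k] Module.Dual k (M ⟶ G.obj) :=
  (toLin.compr₂ G.form).flip

/-- The morphism attached to the generator is the identity, so pairing the left side with ξ gives
the form of `coform ξ` at m, which is ξ(m). Hence the component at the generating object is onto M.
-/
theorem cowedgeMap_gen (m : M.toData.carrier) :
    G.cowedgeMap M G.obj (G.gen ⊗ₜ G.homFunctional M m) = m := by
  rw [← sub_eq_zero, ← Module.forall_dual_apply_eq_zero_iff k]
  intro ξ
  rw [map_sub, G.apply_cowedgeMap, fromGen_gen_self, Category.comp_id, sub_eq_zero]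
  exact G.form_coform M ξ m

theorem eq_cowedgeMap {m : M.toData.carrier} {x : X.toData.carrier} {φ : Module.Dual k (M ⟶ X)}
    (h : ∀ ξ, ξ m = φ (G.coform M ξ ≫ G.fromGen X x)) : m = G.cowedgeMap M X (x ⊗ₜ φ) := by
  rw [← sub_eq_zero, ← Module.forall_dual_apply_eq_zero_iff k]
  intro ξ
  rw [map_sub, G.apply_cowedgeMap, h, sub_self]

theorem homFunctional_cowedgeMap (x : X.toData.carrier) (φ : Module.Dual k (M ⟶ X))
    (g : M ⟶ G.obj) : G.homFunctional M (G.cowedgeMap M X (x ⊗ₜ φ)) g = φ (g ≫ G.fromGen X x) := by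
  have h : g = G.coform M (G.form ∘ₗ toLin g) := G.hom_ext_form _ _ _ fun m => by
    rw [G.form_coform]; rfl
  conv_rhs => rw [h]
  exact G.apply_cowedgeMap (G.form ∘ₗ toLin g) x φ

/-- Moving an endomorphism of the generator across the form. -/
theorem coform_comp_fromGen_apply {y : G.obj.toData.carrier}
    {D : Module.End k G.obj.toData.carrier} {E : Module.End k M.toData.carrier}
    (hD : ∀ q, G.form (toLin (G.fromGen G.obj y) q) = G.form (D q))
    (hE : ∀ (g : M ⟶ G.obj) m, D (toLin g m) = toLin g (E m))
    (ξ : Module.Dual k M.toData.carrier) (x : X.toData.carrier) :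
    G.coform M ξ ≫ G.fromGen X (toLin (G.fromGen X x) y) =
      G.coform M (ξ ∘ₗ E) ≫ G.fromGen X x := by
  have h : G.coform M ξ ≫ G.fromGen G.obj y = G.coform M (ξ ∘ₗ E) :=
    G.hom_ext_form _ _ _ fun m => by
      rw [toLin_comp, hD, hE, G.form_coform, G.form_coform]; rfl
  rw [← h, Category.assoc, G.fromGen_comp]

/-- Transfers an operation on X to an operation on M. In the applications y is the generator moved
by a structure map, so its image under `fromGen x` is x moved by the same map, while E is the
twisted operation. -/
theorem cowedgeMap_apply_tmul {y : G.obj.toData.carrier}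
    {D : Module.End k G.obj.toData.carrier} {E : Module.End k M.toData.carrier}
    (hD : ∀ q, G.form (toLin (G.fromGen G.obj y) q) = G.form (D q))
    (hE : ∀ (g : M ⟶ G.obj) m, D (toLin g m) = toLin g (E m))
    (x : X.toData.carrier) (φ : Module.Dual k (M ⟶ X)) :
    G.cowedgeMap M X (toLin (G.fromGen X x) y ⊗ₜ φ) = E (G.cowedgeMap M X (x ⊗ₜ φ)) := by
  refine (G.eq_cowedgeMap fun ξ => ?_).symm
  rw [G.coform_comp_fromGen_apply hD hE]
  exact G.apply_cowedgeMap (ξ ∘ₗ E) x φ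

section Twist

variable [FiniteDimensional k H]

variable {gA gB : GroupLike k H} {gH : H} {αH : Module.Dual k H}
    {νA : A ≃ₗ[k] A} {νB : B ≃ₗ[k] B}

variable (gA gB gH αH νA νB) in
/-- The form is compatible with the twisted structure maps. -/
structure IsTwistedBy : Prop where
  lact : ∀ a q, G.form (toLin (G.fromGen G.obj (G.obj.toData.lact a G.gen)) q) =
    G.form (G.obj.toData.lact (νA a) q)
  ract : ∀ b q, G.form (toLin (G.fromGen G.obj (G.obj.toData.ract G.gen b)) q) =
    G.form (G.obj.toData.ract q (νB.symm
      (harpoon (LeftComoduleAlgebra.coaction (k := k) (H := H) (A := B)).toLinearMap αH b)))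
  coact : ∀ χ : Module.Dual k H,
    ∀ q, G.form (toLin (G.fromGen G.obj (evalLeft _ χ (G.obj.toData.coact G.gen))) q) =
      G.form (evalLeft _ (χ ∘ₗ coactionTwist gA gB gH) (G.obj.toData.coact q))

variable {G} (hG : G.IsTwistedBy gA gB gH αH νA νB)
include hG

/-- All three compatibilities are instances of `cowedgeMap_apply_tmul`. The coaction is first
contracted with an arbitrary functional on H, which turns it into a family of operators like the
actions. -/
theorem IsTwistedBy.isRelHopfBimodHom_cowedgeMap (φ : Module.Dual k (M ⟶ X)) :
    IsRelHopfBimodHom X.toData (nakayamaTwist gA gB gH αH νA νB M.toData)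
      (G.cowedgeMap M X ∘ₗ (TensorProduct.mk k _ _).flip φ) where
  coact x := by
    refine TensorProduct.ext_dual_left fun χ => ?_
    refine (evalLeft_rTensor χ (coactionTwist gA gB gH) _).trans ?_
    refine Eq.trans ?_ (evalLeft_lTensor χ _ (X.toData.coact x)).symm
    have h := G.cowedgeMap_apply_tmul (M := M)
      (D := evalLeft _ (χ ∘ₗ coactionTwist gA gB gH) ∘ₗ G.obj.toData.coact)
      (E := evalLeft _ (χ ∘ₗ coactionTwist gA gB gH) ∘ₗ M.toData.coact) (hG.coact χ)
      (fun g m => by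
        rw [LinearMap.comp_apply, (isRelHopfBimodHom_toLin g).coact, evalLeft_lTensor]; rfl) x φ
    rw [← evalLeft_lTensor, ← (isRelHopfBimodHom_toLin _).coact, G.fromGen_gen] at h
    exact h.symm
  lact a x := by
    have h := G.cowedgeMap_apply_tmul (M := M) (D := G.obj.toData.lact (νA a))
      (E := M.toData.lact (νA a)) (hG.lact a)
      (fun g m => ((isRelHopfBimodHom_toLin g).lact _ m).symm) x φ
    rw [(isRelHopfBimodHom_toLin _).lact, G.fromGen_gen] at h
    exact h
  ract x b := by
    have h := G.cowedgeMap_apply_tmul (M := M) (D := G.obj.toData.ract.flip _)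
      (E := M.toData.ract.flip _) (hG.ract b)
      (fun g m => ((isRelHopfBimodHom_toLin g).ract m _).symm) x φ
    rw [(isRelHopfBimodHom_toLin _).ract, G.fromGen_gen] at h
    exact h

theorem IsTwistedBy.isRelHopfBimod (M : RelHopfBimod k H A B) :
    IsRelHopfBimod (nakayamaTwist gA gB gH αH νA νB M.toData) := by
  refine G.obj.isRelHopfBimod.of_span
    (hG.isRelHopfBimodHom_cowedgeMap (M := M) (X := G.obj)) ?_
  refine top_le_iff.1 fun m _ => Submodule.subset_span ?_
  exact ⟨G.homFunctional M m, G.gen, G.cowedgeMap_gen m⟩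

variable (M) in
/-- The universal cowedge. -/
noncomputable def IsTwistedBy.cowedge :
    Limits.Cowedge ((nakayamaIntegrand k (copowerFunctor k H A B)).obj M) :=
  Limits.Cowedge.mk
    ((nakayamaTwistFunctor gA gB gH αH νA νB hG.isRelHopfBimod).obj M)
    (fun X => homMk (N := ⟨nakayamaTwist gA gB gH αH νA νB M.toData, hG.isRelHopfBimod M⟩)
      (G.cowedgeMap M X) (isRelHopfBimodHom_copower hG.isRelHopfBimodHom_cowedgeMap))
    (fun X X' f => toLin_injective <| TensorProduct.ext' fun x φ => by
      refine Eq.trans ?_ (?_ : G.cowedgeMap M X (x ⊗ₜ (φ ∘ₗ Linear.rightComp k M f)) =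
        G.cowedgeMap M X' (toLin f x ⊗ₜ φ))
      · rfl
      · refine G.eq_cowedgeMap fun ξ => ?_
        rw [G.apply_cowedgeMap, ← G.fromGen_comp, ← Category.assoc]
        rfl)

section Desc

variable {Y : RelHopfBimod k H A B}
  {θ : ∀ X : RelHopfBimod k H A B, X.copowerObj (Module.Dual k (M ⟶ X)) ⟶ Y}
  (hθ : ∀ (X X' : RelHopfBimod k H A B) (f : X ⟶ X') (φ : Module.Dual k (M ⟶ X'))
    (x : X.toData.carrier),
    toLin (θ X) (x ⊗ₜ[k] (φ ∘ₗ Linear.rightComp k M f)) = toLin (θ X') (toLin f x ⊗ₜ[k] φ))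

omit hG [FiniteDimensional k H]

variable (G θ) in
/-- The linear map out of `M` induced by a cowedge. -/
noncomputable def descMap : M.toData.carrier →ₗ[k] Y.toData.carrier :=
  toLin (θ G.obj) ∘ₗ TensorProduct.mk k _ _ G.gen ∘ₗ G.homFunctional M

include hθ

/-- The cowedge relation along the morphism G → X that sends the generator to x moves the component
at X back to the component at G. -/
theorem descMap_cowedgeMap (x : X.toData.carrier) (φ : Module.Dual k (M ⟶ X)) :
    G.descMap θ (G.cowedgeMap M X (x ⊗ₜ φ)) = toLin (θ X) (x ⊗ₜ[k] φ) := by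
  have h : G.homFunctional M (G.cowedgeMap M X (x ⊗ₜ φ)) =
      φ ∘ₗ Linear.rightComp k M (G.fromGen X x) :=
    LinearMap.ext fun g => G.homFunctional_cowedgeMap x φ g
  have h2 := hθ G.obj X (G.fromGen X x) φ G.gen
  rw [← h, G.fromGen_gen] at h2
  exact h2

include hG

theorem IsTwistedBy.isRelHopfBimodHom_descMap [FiniteDimensional k H] :
    IsRelHopfBimodHom (nakayamaTwist gA gB gH αH νA νB M.toData) Y.toData (G.descMap θ) := by
  refine IsRelHopfBimodHom.of_lift (X := G.obj.toData) fun m => ⟨_, G.gen, G.cowedgeMap_gen m,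
    hG.isRelHopfBimodHom_cowedgeMap (G.homFunctional M m), ?_⟩
  have h : G.descMap θ ∘ₗ G.cowedgeMap M G.obj ∘ₗ
      (TensorProduct.mk k _ _).flip (G.homFunctional M m) =
        toLin (copowerHomEquiv _ _ (θ G.obj) (G.homFunctional M m)) :=
    LinearMap.ext fun x => descMap_cowedgeMap hθ x _
  exact h ▸ isRelHopfBimodHom_toLin _

end Desc

omit hG [FiniteDimensional k H] in
theorem cowedge_condition (K : Limits.Cowedge ((nakayamaIntegrand k (copowerFunctor k H A B)).obj M))
    (X X' : RelHopfBimod k H A B) (f : X ⟶ X') (φ : Module.Dual k (M ⟶ X'))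
    (x : X.toData.carrier) :
    toLin (M := X.copowerObj (Module.Dual k (M ⟶ X))) (K.π X)
        (x ⊗ₜ[k] (φ ∘ₗ Linear.rightComp k M f)) =
      toLin (M := X'.copowerObj (Module.Dual k (M ⟶ X'))) (K.π X') (toLin f x ⊗ₜ[k] φ) :=
  LinearMap.congr_fun (congrArg toLin (Limits.Cowedge.condition K f)) (x ⊗ₜ[k] φ)

variable (M) in
/-- The cowedge is universal. -/
noncomputable def IsTwistedBy.isColimitCowedge : Limits.IsColimit (hG.cowedge M) :=
  Limits.Multicofork.IsColimit.mk _
    (fun K => homMk (M := ⟨nakayamaTwist gA gB gH αH νA νB M.toData, hG.isRelHopfBimod M⟩)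
      (G.descMap (M := M) (Y := K.pt) fun X => K.π X) (hG.isRelHopfBimodHom_descMap (cowedge_condition K)))
    (fun K X => toLin_injective <| TensorProduct.ext' fun x φ =>
      descMap_cowedgeMap (cowedge_condition K) x φ)
    -- Uniqueness: the component at the generating object already reaches every m.
    (fun K d hd => hom_ext fun m => by
      have h := LinearMap.congr_fun (congrArg toLin (hd G.obj)) (G.gen ⊗ₜ[k] G.homFunctional M m)
      exact Eq.trans (congrArg (toLin d) (G.cowedgeMap_gen (M := M) m).symm) h)

/-- The coend is the twisted object itself, so the comparison isomorphisms are identities. What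
remains is naturality in M, which is dual to `coform_comp`. -/
theorem IsTwistedBy.isNakayamaFunctor :
    IsNakayamaFunctor k (nakayamaTwistFunctor gA gB gH αH νA νB hG.isRelHopfBimod) := by
  refine ⟨copowerFunctor k H A B, ⟨copowerAdj₂ k H A B⟩, fun M => hG.cowedge M,
    fun M => ⟨hG.isColimitCowedge M⟩, fun M => Iso.refl _, fun M M' f X => ?_⟩
  refine toLin_injective (TensorProduct.ext' fun x φ => ?_)
  change G.cowedgeMap M' X (x ⊗ₜ (φ ∘ₗ Linear.leftComp k X f)) =
    toLin f (G.cowedgeMap M X (x ⊗ₜ φ))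
  refine (G.eq_cowedgeMap fun ξ => ?_).symm
  refine (G.apply_cowedgeMap (ξ ∘ₗ toLin f) x φ).trans ?_
  rw [← G.coform_comp, Category.assoc]
  rfl

end Twist

end FrobeniusGenerator

end FrobeniusGenerator

/-! ### Bilinear forms on A × B as a bimodule -/

section BilinForms

variable {k : Type*} (A B : Type*) [Field k] [Ring A] [Algebra k A] [Ring B] [Algebra k B]

/-- The left action `(a v)(x, y) = v(x a, y)` on bilinear forms. -/
def bilinLact : A →ₗ[k] (A →ₗ[k] B →ₗ[k] k) →ₗ[k] (A →ₗ[k] B →ₗ[k] k) :=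
  (LinearMap.llcomp k A A (B →ₗ[k] k)).flip ∘ₗ (LinearMap.mul k A).flip

/-- The right action `(v b)(x, y) = v(x, b y)` on bilinear forms. -/
def bilinRact : (A →ₗ[k] B →ₗ[k] k) →ₗ[k] B →ₗ[k] (A →ₗ[k] B →ₗ[k] k) :=
  LinearMap.mk₂ k (fun v b => v.compl₂ (LinearMap.mulLeft k b))
    (fun _ _ _ => rfl) (fun _ _ _ => rfl)
    (fun v b b' => by ext x y; simp [add_mul]) (fun c v b => by ext x y; simp)

variable {A B}

@[simp]
theorem bilinLact_apply (a : A) (v : A →ₗ[k] B →ₗ[k] k) (x : A) (y : B) :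
    bilinLact A B a v x y = v (x * a) y := rfl

@[simp]
theorem bilinRact_apply (v : A →ₗ[k] B →ₗ[k] k) (b : B) (x : A) (y : B) :
    bilinRact A B v b x y = v x (b * y) := rfl

end BilinForms

/-! ### The cofree relative Hopf bimodule H ⊗ V -/

section Cofree

variable (k H A B : Type u) [Field k] [Ring H] [HopfAlgebra k H]
  [Ring A] [Algebra k A] [Ring B] [Algebra k B]

local notation "V" => A →ₗ[k] B →ₗ[k] k

/-- The coaction of the cofree comodule over the bilinear forms on `A × B`. -/
noncomputable def cofreeCoact : H ⊗[k] V →ₗ[k] H ⊗[k] (H ⊗[k] V) :=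
  (TensorProduct.assoc k H H V).toLinearMap ∘ₗ (Coalgebra.comul (R := k) (A := H)).rTensor V

/-- The diagonal left action on the cofree comodule over the bilinear forms on `A × B`. -/
noncomputable def cofreeLact [LeftComoduleAlgebra k H A] : A →ₗ[k] H ⊗[k] V →ₗ[k] H ⊗[k] V :=
  TensorProduct.map₂ (LinearMap.mul k H) (bilinLact A B) ∘ₗ
    (LeftComoduleAlgebra.coaction (k := k) (H := H) (A := A)).toLinearMap

/-- The diagonal right action on the cofree comodule over the bilinear forms on `A × B`. -/
noncomputable def cofreeRact [LeftComoduleAlgebra k H B] : H ⊗[k] V →ₗ[k] B →ₗ[k] H ⊗[k] V :=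
  (TensorProduct.map₂ (LinearMap.mul k H) (bilinRact A B)).compl₂
    (LeftComoduleAlgebra.coaction (k := k) (H := H) (A := B)).toLinearMap

variable {k H A B}

theorem cofree_coact_tmul (h : H) (v : V) : cofreeCoact k H A B (h ⊗ₜ v) =
    ((TensorProduct.mk k H V).flip v).lTensor H (Coalgebra.comul (R := k) h) := by
  change TensorProduct.assoc k H H V (Coalgebra.comul (R := k) h ⊗ₜ v) = _
  induction Coalgebra.comul (R := k) h with
  | zero => simp
  | add x y hx hy => simp only [TensorProduct.add_tmul, map_add, hx, hy]
  | tmul x m => simp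

theorem map₂_bilinLact_mul (z z' : H ⊗[k] A) (t : H ⊗[k] V) :
    TensorProduct.map₂ (LinearMap.mul k H) (bilinLact A B) (z * z') t =
      TensorProduct.map₂ (LinearMap.mul k H) (bilinLact A B) z
        (TensorProduct.map₂ (LinearMap.mul k H) (bilinLact A B) z' t) := by
  induction z with
  | zero => simp
  | add x y hx hy => simp only [add_mul, map_add, LinearMap.add_apply, hx, hy]
  | tmul p a =>
    induction z' with
    | zero => simp
    | add x y hx hy => simp only [mul_add, map_add, LinearMap.add_apply, hx, hy]
    | tmul p' a' =>
      induction t with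
      | zero => simp
      | add x y hx hy => simp only [map_add, hx, hy]
      | tmul q v =>
        simp only [Algebra.TensorProduct.tmul_mul_tmul, TensorProduct.map₂_apply_tmul,
          TensorProduct.map_tmul, LinearMap.mul_apply', mul_assoc]
        congr 1
        ext x y
        simp [mul_assoc]

theorem map₂_bilinRact_mul (z z' : H ⊗[k] B) (t : H ⊗[k] V) :
    TensorProduct.map₂ (LinearMap.mul k H) (bilinRact A B) t (z * z') =
      TensorProduct.map₂ (LinearMap.mul k H) (bilinRact A B)
        (TensorProduct.map₂ (LinearMap.mul k H) (bilinRact A B) t z) z' := by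
  induction z with
  | zero => simp
  | add x y hx hy => simp only [add_mul, map_add, LinearMap.add_apply, hx, hy]
  | tmul p a =>
    induction z' with
    | zero => simp
    | add x y hx hy => simp only [mul_add, map_add, hx, hy]
    | tmul p' a' =>
      induction t with
      | zero => simp
      | add x y hx hy => simp only [map_add, LinearMap.add_apply, hx, hy]
      | tmul q v =>
        simp only [Algebra.TensorProduct.tmul_mul_tmul, TensorProduct.map₂_apply_tmul,
          TensorProduct.map_tmul, LinearMap.mul_apply', mul_assoc]
        congr 1
        ext x y
        simp [mul_assoc]

theorem map₂_bilinLact_bilinRact (z : H ⊗[k] A) (z' : H ⊗[k] B) (t : H ⊗[k] V) :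
    TensorProduct.map₂ (LinearMap.mul k H) (bilinRact A B)
        (TensorProduct.map₂ (LinearMap.mul k H) (bilinLact A B) z t) z' =
      TensorProduct.map₂ (LinearMap.mul k H) (bilinLact A B) z
        (TensorProduct.map₂ (LinearMap.mul k H) (bilinRact A B) t z') := by
  induction z with
  | zero => simp
  | add x y hx hy => simp only [map_add, LinearMap.add_apply, hx, hy]
  | tmul p a =>
    induction z' with
    | zero => simp
    | add x y hx hy => simp only [map_add, hx, hy]
    | tmul p' a' =>
      induction t with
      | zero => simp
      | add x y hx hy => simp only [map_add, LinearMap.add_apply, hx, hy]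
      | tmul q v =>
        simp only [TensorProduct.map₂_apply_tmul,
          TensorProduct.map_tmul, LinearMap.mul_apply', mul_assoc]
        rfl

/-- Multiplicativity of Δ in the H-leg. An arbitrary z in place of the coaction of an element of A
makes induction on tensors available; coassociativity is applied afterwards. -/
theorem cofree_coact_map₂_bilinLact (z : H ⊗[k] A) (t : H ⊗[k] V) :
    cofreeCoact k H A B (TensorProduct.map₂ (LinearMap.mul k H) (bilinLact A B) z t) =
      TensorProduct.map₂ (LinearMap.mul k H)
        (TensorProduct.map₂ (LinearMap.mul k H) (bilinLact A B))
        (TensorProduct.assoc k H H A ((Coalgebra.comul (R := k) (A := H)).rTensor A z))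
        (cofreeCoact k H A B t) := by
  induction z with
  | zero => simp
  | add x y hx hy => simp only [map_add, LinearMap.add_apply, hx, hy]
  | tmul p a =>
    induction t with
    | zero => simp
    | add x y hx hy => simp only [map_add, hx, hy]
    | tmul q v =>
      rw [TensorProduct.map₂_apply_tmul, TensorProduct.map_tmul, LinearMap.mul_apply',
        cofree_coact_tmul, cofree_coact_tmul, LinearMap.rTensor_tmul, Bialgebra.comul_mul]
      induction Coalgebra.comul (R := k) p with
      | zero => simp
      | add x y hx hy =>
        simp only [add_mul, TensorProduct.add_tmul, map_add, LinearMap.add_apply, hx, hy]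
      | tmul x y =>
        induction Coalgebra.comul (R := k) q with
        | zero => simp
        | add x y hx hy => simp only [mul_add, map_add, hx, hy]
        | tmul x' y' => simp

theorem cofree_coact_map₂_bilinRact (z : H ⊗[k] B) (t : H ⊗[k] V) :
    cofreeCoact k H A B (TensorProduct.map₂ (LinearMap.mul k H) (bilinRact A B) t z) =
      TensorProduct.map₂ (LinearMap.mul k H)
        (TensorProduct.map₂ (LinearMap.mul k H) (bilinRact A B)) (cofreeCoact k H A B t)
        (TensorProduct.assoc k H H B ((Coalgebra.comul (R := k) (A := H)).rTensor B z)) := by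
  induction z with
  | zero => simp
  | add x y hx hy => simp only [map_add, hx, hy]
  | tmul p a =>
    induction t with
    | zero => simp
    | add x y hx hy => simp only [map_add, LinearMap.add_apply, hx, hy]
    | tmul q v =>
      rw [TensorProduct.map₂_apply_tmul, TensorProduct.map_tmul, LinearMap.mul_apply',
        cofree_coact_tmul, cofree_coact_tmul, LinearMap.rTensor_tmul, Bialgebra.comul_mul]
      induction Coalgebra.comul (R := k) p with
      | zero => simp
      | add x y hx hy => simp only [mul_add, TensorProduct.add_tmul, map_add, hx, hy]
      | tmul x y =>
        induction Coalgebra.comul (R := k) q with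
        | zero => simp
        | add x y hx hy => simp only [add_mul, map_add, LinearMap.add_apply, hx, hy]
        | tmul x' y' => simp

theorem map₂_cofree_lact [LeftComoduleAlgebra k H A]
    (z : H ⊗[k] A) (t : H ⊗[k] (H ⊗[k] V)) :
    TensorProduct.map₂ (LinearMap.mul k H) (cofreeLact k H A B) z t =
      TensorProduct.map₂ (LinearMap.mul k H)
        (TensorProduct.map₂ (LinearMap.mul k H) (bilinLact A B))
        ((LeftComoduleAlgebra.coaction (k := k) (H := H)).toLinearMap.lTensor H z) t := by
  induction z with
  | zero => simp
  | add x y hx hy => simp only [map_add, LinearMap.add_apply, hx, hy]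
  | tmul p a => rfl

theorem map₂_cofree_ract [LeftComoduleAlgebra k H B] (z : H ⊗[k] B) (t : H ⊗[k] (H ⊗[k] V)) :
    TensorProduct.map₂ (LinearMap.mul k H) (cofreeRact k H A B) t z =
      TensorProduct.map₂ (LinearMap.mul k H)
        (TensorProduct.map₂ (LinearMap.mul k H) (bilinRact A B)) t
        ((LeftComoduleAlgebra.coaction (k := k) (H := H)).toLinearMap.lTensor H z) := by
  induction z with
  | zero => simp
  | add x y hx hy => simp only [map_add, hx, hy]
  | tmul p a =>
    induction t with
    | zero => simp
    | add x y hx hy => simp only [map_add, LinearMap.add_apply, hx, hy]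
    | tmul q v => rfl

theorem cofreeLact_one [LeftComoduleAlgebra k H A] (t : H ⊗[k] V) : cofreeLact k H A B 1 t = t := by
  refine LinearMap.congr_fun (g := LinearMap.id) (TensorProduct.ext' fun h v => ?_) t
  rw [cofreeLact, LinearMap.comp_apply, AlgHom.toLinearMap_apply, map_one,
    Algebra.TensorProduct.one_def, TensorProduct.map₂_apply_tmul,
    TensorProduct.map_tmul, LinearMap.mul_apply', one_mul]
  exact congrArg (h ⊗ₜ[k] ·) (LinearMap.ext₂ fun x y => by simp)

theorem cofreeRact_one [LeftComoduleAlgebra k H B] (t : H ⊗[k] V) : cofreeRact k H A B t 1 = t := by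
  refine LinearMap.congr_fun (f := (cofreeRact k H A B).flip 1) (g := LinearMap.id)
    (TensorProduct.ext' fun h v => ?_) t
  rw [LinearMap.flip_apply, cofreeRact, LinearMap.compl₂_apply, AlgHom.toLinearMap_apply, map_one,
    Algebra.TensorProduct.one_def, TensorProduct.map₂_apply_tmul,
    TensorProduct.map_tmul, LinearMap.mul_apply', mul_one]
  exact congrArg (h ⊗ₜ[k] ·) (LinearMap.ext₂ fun x y => by simp)

theorem cofreeLact_mul [LeftComoduleAlgebra k H A] (a a' : A) (t : H ⊗[k] V) :
    cofreeLact k H A B (a * a') t = cofreeLact k H A B a (cofreeLact k H A B a' t) := by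
  simp only [cofreeLact, LinearMap.comp_apply, AlgHom.toLinearMap_apply, map_mul,
    map₂_bilinLact_mul]

theorem cofreeRact_mul [LeftComoduleAlgebra k H B] (t : H ⊗[k] V) (b b' : B) :
    cofreeRact k H A B t (b * b') = cofreeRact k H A B (cofreeRact k H A B t b) b' := by
  simp only [cofreeRact, LinearMap.compl₂_apply, AlgHom.toLinearMap_apply, map_mul,
    map₂_bilinRact_mul]

theorem cofreeCoact_lact [LeftComoduleAlgebra k H A] (a : A) (t : H ⊗[k] V) : cofreeCoact k H A B (cofreeLact k H A B a t) =
    TensorProduct.map₂ (LinearMap.mul k H) (cofreeLact k H A B)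
      (LeftComoduleAlgebra.coaction (k := k) (H := H) a) (cofreeCoact k H A B t) := by
  rw [map₂_cofree_lact]
  refine (cofree_coact_map₂_bilinLact _ t).trans ?_
  exact congrArg (fun z => TensorProduct.map₂ (LinearMap.mul k H)
    (TensorProduct.map₂ (LinearMap.mul k H) (bilinLact A B)) z (cofreeCoact k H A B t))
    (LinearMap.congr_fun
      (LeftComoduleAlgebra.isLeftCoaction (k := k) (H := H) (A := A)).coassoc a)

theorem cofreeCoact_ract [LeftComoduleAlgebra k H B] (t : H ⊗[k] V) (b : B) : cofreeCoact k H A B (cofreeRact k H A B t b) =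
    TensorProduct.map₂ (LinearMap.mul k H) (cofreeRact k H A B) (cofreeCoact k H A B t)
      (LeftComoduleAlgebra.coaction (k := k) (H := H) b) := by
  rw [map₂_cofree_ract]
  refine (cofree_coact_map₂_bilinRact _ t).trans ?_
  exact congrArg (TensorProduct.map₂ (LinearMap.mul k H)
    (TensorProduct.map₂ (LinearMap.mul k H) (bilinRact A B)) (cofreeCoact k H A B t))
    (LinearMap.congr_fun
      (LeftComoduleAlgebra.isLeftCoaction (k := k) (H := H) (A := B)).coassoc b)

variable [LeftComoduleAlgebra k H A] [LeftComoduleAlgebra k H B]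
  [FiniteDimensional k H] [FiniteDimensional k A] [FiniteDimensional k B]

variable (k H A B) in
/-- The structure maps on the cofree comodule over the bilinear forms on `A × B`. -/
noncomputable def cofreeData : RelHopfBimodData k H A B where
  carrier := H ⊗[k] V
  coact := cofreeCoact k H A B
  lact := cofreeLact k H A B
  ract := cofreeRact k H A B

variable (k H A B) in
theorem isRelHopfBimod_cofree : IsRelHopfBimod (cofreeData k H A B) where
  isLeftCoaction := by
    refine isLeftCoaction_comul.of_span (f := fun v => (TensorProduct.mk k H V).flip v) ?_
      fun v h => cofree_coact_tmul h v
    refine Eq.trans ?_ (TensorProduct.span_tmul_eq_top k H V)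
    refine congrArg (Submodule.span k) (Set.ext fun t => ?_)
    exact exists_comm
  one_lact := cofreeLact_one
  mul_lact := cofreeLact_mul
  ract_one := cofreeRact_one
  ract_mul := cofreeRact_mul
  lact_ract a t b := map₂_bilinLact_bilinRact _ _ t
  coact_lact := cofreeCoact_lact
  coact_ract := cofreeCoact_ract

variable (k H A B) in
/-- The cofree relative Hopf bimodule over the bilinear forms on `A × B`. -/
noncomputable def cofreeObj : RelHopfBimod k H A B :=
  ⟨cofreeData k H A B, isRelHopfBimod_cofree k H A B⟩

end Cofree

/-! ### Cofreeness: morphisms into H ⊗ V are linear forms -/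

section Coform

open RelHopfBimod

variable {k H A B : Type u} [Field k] [Ring H] [HopfAlgebra k H]
  [Ring A] [Algebra k A] [Ring B] [Algebra k B]

local notation "V" => A →ₗ[k] B →ₗ[k] k

theorem evalLeft_cofreeCoact (χ : Module.Dual k H) (φ : Module.Dual k H) (t : H ⊗[k] V) :
    evalLeft V φ (evalLeft (H ⊗[k] V) χ (cofreeCoact k H A B t)) =
      evalLeft V (χ ∘ₗ evalRight H φ ∘ₗ Coalgebra.comul (R := k)) t := by
  induction t with
  | zero => simp
  | add x y hx hy => simp only [map_add, hx, hy]
  | tmul h v =>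
    rw [cofree_coact_tmul, evalLeft_lTensor, evalLeft_tmul]
    simp only [LinearMap.comp_apply]
    induction Coalgebra.comul (R := k) h with
    | zero => simp
    | add x y hx hy => simp only [map_add, hx, hy, add_smul]
    | tmul x y => simp [smul_smul, mul_comm]

theorem evalLeft_counit_evalLeft_cofreeCoact (χ : Module.Dual k H) (t : H ⊗[k] V) :
    evalLeft V (Coalgebra.counit (R := k)) (evalLeft (H ⊗[k] V) χ (cofreeCoact k H A B t)) =
      evalLeft V χ t := by
  rw [evalLeft_cofreeCoact]
  congr 2
  ext h
  simp [evalRight]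

theorem evalLeft_counit_map₂_bilinLact (z : H ⊗[k] A) (t : H ⊗[k] V) :
    evalLeft V (Coalgebra.counit (R := k))
        (TensorProduct.map₂ (LinearMap.mul k H) (bilinLact A B) z t) =
      bilinLact A B (evalLeft A (Coalgebra.counit (R := k)) z)
        (evalLeft V (Coalgebra.counit (R := k)) t) := by
  induction z with
  | zero => simp
  | add x y hx hy => simp only [map_add, LinearMap.add_apply, hx, hy]
  | tmul x a =>
    induction t with
    | zero => simp
    | add x y hx hy => simp only [map_add, hx, hy]
    | tmul y v => simp [smul_smul, mul_comm]

theorem evalLeft_counit_map₂_bilinRact (z : H ⊗[k] B) (t : H ⊗[k] V) :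
    evalLeft V (Coalgebra.counit (R := k))
        (TensorProduct.map₂ (LinearMap.mul k H) (bilinRact A B) t z) =
      bilinRact A B (evalLeft V (Coalgebra.counit (R := k)) t)
        (evalLeft B (Coalgebra.counit (R := k)) z) := by
  induction z with
  | zero => simp
  | add x y hx hy => simp only [map_add, hx, hy]
  | tmul x a =>
    induction t with
    | zero => simp
    | add x y hx hy => simp only [map_add, LinearMap.add_apply, hx, hy]
    | tmul y v => simp [smul_smul, mul_comm]

theorem IsLeftCoaction.evalLeft_counit {M : Type u} [AddCommGroup M] [Module k M]
    {δ : M →ₗ[k] H ⊗[k] M} (hδ : IsLeftCoaction δ) (m : M) :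
    evalLeft M (Coalgebra.counit (R := k)) (δ m) = m :=
  LinearMap.congr_fun hδ.counit m

theorem evalLeft_counit_cofreeLact [LeftComoduleAlgebra k H A] (a : A) (t : H ⊗[k] V) :
    evalLeft V (Coalgebra.counit (R := k)) (cofreeLact k H A B a t) =
      bilinLact A B a (evalLeft V (Coalgebra.counit (R := k)) t) := by
  refine (evalLeft_counit_map₂_bilinLact _ t).trans ?_
  rw [LeftComoduleAlgebra.isLeftCoaction.evalLeft_counit]

theorem evalLeft_counit_cofreeRact [LeftComoduleAlgebra k H B] (b : B) (t : H ⊗[k] V) :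
    evalLeft V (Coalgebra.counit (R := k)) (cofreeRact k H A B t b) =
      bilinRact A B (evalLeft V (Coalgebra.counit (R := k)) t) b := by
  refine (evalLeft_counit_map₂_bilinRact _ t).trans ?_
  rw [LeftComoduleAlgebra.isLeftCoaction.evalLeft_counit]

variable (k H A B) in
/-- The linear form `h ⊗ v ↦ ε(h) v(1, 1)` on the cofree object. -/
noncomputable def cofreeForm : Module.Dual k (H ⊗[k] V) :=
  LinearMap.applyₗ (1 : B) ∘ₗ LinearMap.applyₗ (1 : A) ∘ₗ evalLeft V (Coalgebra.counit (R := k))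

theorem cofreeForm_apply (t : H ⊗[k] V) :
    cofreeForm k H A B t = evalLeft V (Coalgebra.counit (R := k)) t 1 1 := rfl

theorem cofreeForm_lact_ract [LeftComoduleAlgebra k H A] [LeftComoduleAlgebra k H B]
    (a : A) (b : B) (t : H ⊗[k] V) :
    cofreeForm k H A B (cofreeRact k H A B (cofreeLact k H A B a t) b) =
      evalLeft V (Coalgebra.counit (R := k)) t a b := by
  simp [cofreeForm_apply, evalLeft_counit_cofreeLact, evalLeft_counit_cofreeRact]

theorem cofreeForm_evalLeft_cofreeCoact (χ : Module.Dual k H) (t : H ⊗[k] V) :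
    cofreeForm k H A B (evalLeft (H ⊗[k] V) χ (cofreeCoact k H A B t)) = evalLeft V χ t 1 1 := by
  rw [cofreeForm_apply, evalLeft_counit_evalLeft_cofreeCoact]

/-- The map `m ↦ ((a, b) ↦ ξ(a m b))`. -/
noncomputable def bilinCoform (M : RelHopfBimodData k H A B) (ξ : Module.Dual k M.carrier) :
    M.carrier →ₗ[k] V :=
  LinearMap.llcomp k A M.carrier (B →ₗ[k] k) (M.ract.compr₂ ξ) ∘ₗ M.lact.flip

@[simp]
theorem bilinCoform_apply (M : RelHopfBimodData k H A B) (ξ : Module.Dual k M.carrier)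
    (m : M.carrier) (a : A) (b : B) : bilinCoform M ξ m a b = ξ (M.ract (M.lact a m) b) := rfl

/-- The map `m ↦ m_{(-1)} ⊗ ((a, b) ↦ ξ(a m_{(0)} b))`. -/
noncomputable def cofreeCoform (M : RelHopfBimodData k H A B) (ξ : Module.Dual k M.carrier) :
    M.carrier →ₗ[k] H ⊗[k] V :=
  (bilinCoform M ξ).lTensor H ∘ₗ M.coact

theorem cofreeCoact_lTensor {M : Type*} [AddCommGroup M] [Module k M] (f : M →ₗ[k] V)
    (w : H ⊗[k] M) : cofreeCoact k H A B (f.lTensor H w) = (f.lTensor H).lTensor H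
      (TensorProduct.assoc k H H M ((Coalgebra.comul (R := k)).rTensor M w)) := by
  induction w with
  | zero => simp
  | add x y hx hy => simp only [map_add, hx, hy]
  | tmul h m =>
    rw [LinearMap.lTensor_tmul, cofree_coact_tmul, LinearMap.rTensor_tmul]
    induction Coalgebra.comul (R := k) h with
    | zero => simp
    | add x y hx hy => simp only [map_add, TensorProduct.add_tmul, hx, hy]
    | tmul x y => simp

variable [LeftComoduleAlgebra k H A] [LeftComoduleAlgebra k H B]

section

variable {M : RelHopfBimodData k H A B} (hM : IsRelHopfBimod M) (ξ : Module.Dual k M.carrier)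
include hM

theorem IsRelHopfBimod.cofreeCoact_cofreeCoform (m : M.carrier) :
    cofreeCoact k H A B (cofreeCoform M ξ m) = (cofreeCoform M ξ).lTensor H (M.coact m) := by
  refine (cofreeCoact_lTensor _ _).trans ?_
  refine (congrArg (((bilinCoform M ξ).lTensor H).lTensor H)
    (LinearMap.congr_fun hM.isLeftCoaction.coassoc m)).trans ?_
  exact (LinearMap.congr_fun (LinearMap.lTensor_comp H ((bilinCoform M ξ).lTensor H) M.coact)
    (M.coact m)).symm

theorem IsRelHopfBimod.cofreeCoform_lact (a : A) (m : M.carrier) :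
    cofreeCoform M ξ (M.lact a m) = cofreeLact k H A B a (cofreeCoform M ξ m) := by
  have h : ∀ a m, bilinCoform M ξ (M.lact a m) = bilinLact A B a (bilinCoform M ξ m) :=
    fun a' m' => LinearMap.ext₂ fun x y => by simp [hM.mul_lact]
  rw [cofreeCoform, LinearMap.comp_apply, hM.coact_lact, ← TensorProduct.map₂_lTensor_right _ _ _ _ _ h]
  rfl

theorem IsRelHopfBimod.cofreeCoform_ract (m : M.carrier) (b : B) :
    cofreeCoform M ξ (M.ract m b) = cofreeRact k H A B (cofreeCoform M ξ m) b := by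
  have h : ∀ b m, bilinCoform M ξ (M.ract m b) = bilinRact A B (bilinCoform M ξ m) b :=
    fun b' m' => LinearMap.ext₂ fun x y => by simp [hM.ract_mul, hM.lact_ract]
  rw [cofreeCoform, LinearMap.comp_apply, hM.coact_ract, ← TensorProduct.map₂_lTensor_left _ _ _ _ _ h]
  rfl

theorem IsRelHopfBimod.cofreeForm_cofreeCoform (m : M.carrier) :
    cofreeForm k H A B (cofreeCoform M ξ m) = ξ m := by
  rw [cofreeForm_apply, cofreeCoform, LinearMap.comp_apply, evalLeft_lTensor,
    hM.isLeftCoaction.evalLeft_counit]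
  simp [hM.one_lact, hM.ract_one]

end

variable [FiniteDimensional k H] [FiniteDimensional k A] [FiniteDimensional k B]

/-- The form recovers f: contracting f(m) with χ and evaluating at (a, b) gives the form of f at a ·
χ(m_{(-1)}) m_{(0)} · b, because f respects the actions and the coaction. -/
theorem cofree_hom_ext {M : RelHopfBimodData k H A B} {f g : M.carrier →ₗ[k] H ⊗[k] V}
    (hf : IsRelHopfBimodHom M (cofreeData k H A B) f)
    (hg : IsRelHopfBimodHom M (cofreeData k H A B) g)
    (h : ∀ m, cofreeForm k H A B (f m) = cofreeForm k H A B (g m)) : f = g := by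
  have key : ∀ (f : M.carrier →ₗ[k] H ⊗[k] V), IsRelHopfBimodHom M (cofreeData k H A B) f →
      ∀ χ m a b, evalLeft V χ (f m) a b =
        cofreeForm k H A B (f (M.ract (M.lact a (evalLeft M.carrier χ (M.coact m))) b)) := by
    intro f hf χ m a b
    have h1 : cofreeCoact k H A B (f m) = f.lTensor H (M.coact m) := hf.coact m
    have h2 : ∀ a m, f (M.lact a m) = cofreeLact k H A B a (f m) := hf.lact
    have h3 : ∀ m b, f (M.ract m b) = cofreeRact k H A B (f m) b := hf.ract
    rw [h3, h2, cofreeForm_lact_ract, ← evalLeft_lTensor, ← h1,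
      evalLeft_counit_evalLeft_cofreeCoact]
  refine LinearMap.ext fun m => ?_
  refine TensorProduct.ext_dual_left (H := H) (M := V) fun χ => LinearMap.ext₂ fun a b => ?_
  exact (key f hf χ m a b).trans ((h _).trans (key g hg χ m a b).symm)

/-- The morphism to the cofree object that corresponds to a linear form. -/
noncomputable def cofreeCoformHom (M : RelHopfBimod k H A B) :
    Module.Dual k M.toData.carrier →ₗ[k] (M ⟶ cofreeObj k H A B) where
  toFun ξ := homMk (N := cofreeObj k H A B) (cofreeCoform M.toData ξ)
    ⟨M.isRelHopfBimod.cofreeCoact_cofreeCoform ξ, M.isRelHopfBimod.cofreeCoform_lact ξ,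
      M.isRelHopfBimod.cofreeCoform_ract ξ⟩
  map_add' ξ η := toLin_injective <| by
    have h : bilinCoform M.toData (ξ + η) = bilinCoform M.toData ξ + bilinCoform M.toData η := rfl
    have h2 : cofreeCoform M.toData (ξ + η) = cofreeCoform M.toData ξ + cofreeCoform M.toData η := by
      rw [cofreeCoform, h, LinearMap.lTensor_add, LinearMap.add_comp]; rfl
    exact h2
  map_smul' c ξ := toLin_injective <| by
    have h : bilinCoform M.toData (c • ξ) = c • bilinCoform M.toData ξ := rfl
    have h2 : cofreeCoform M.toData (c • ξ) = c • cofreeCoform M.toData ξ := by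
      rw [cofreeCoform, h, LinearMap.lTensor_smul, LinearMap.smul_comp]; rfl
    exact h2

end Coform

/-! ### Orbits under a left and a right action -/

section OrbitMap

variable {k H A B X : Type*} [Field k] [AddCommGroup H] [Module k H]
  [AddCommGroup A] [Module k A] [AddCommGroup B] [Module k B] [AddCommGroup X] [Module k X]

/-- The map `a ⊗ h ⊗ b ↦ a ρ(h) b`. -/
noncomputable def orbitMap (lact : A →ₗ[k] X →ₗ[k] X) (ract : X →ₗ[k] B →ₗ[k] X) (ρ : H →ₗ[k] X) :
    (A ⊗[k] H) ⊗[k] B →ₗ[k] X :=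
  TensorProduct.lift (ract ∘ₗ TensorProduct.lift lact ∘ₗ ρ.lTensor A)

@[simp]
theorem orbitMap_tmul (lact : A →ₗ[k] X →ₗ[k] X) (ract : X →ₗ[k] B →ₗ[k] X) (ρ : H →ₗ[k] X)
    (a : A) (h : H) (b : B) :
    orbitMap lact ract ρ ((a ⊗ₜ h) ⊗ₜ b) = ract (lact a (ρ h)) b := rfl

end OrbitMap

/-! ### Freeness of H ⊗ V over A and B -/

section CofreeOrbit

variable {k H A B : Type u} [Field k] [Ring H] [HopfAlgebra k H]
  [Ring A] [Algebra k A] [Ring B] [Algebra k B]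

local notation "V" => A →ₗ[k] B →ₗ[k] k

/-- Non-degeneracy provides bases dual to `e` and `e'` under the traces, so the translates of lA ⊗
lB include the coordinate forms of V. -/
theorem IsFrobeniusTrace.exists_sum_bilin [FiniteDimensional k A] [FiniteDimensional k B]
    {lA : Module.Dual k A} {lB : Module.Dual k B} (hA : IsFrobeniusTrace lA)
    (hB : IsFrobeniusTrace lB) (W : Submodule k V)
    (hW : ∀ a b, bilinLact A B a (bilinRact A B (lA.smulRight lB) b) ∈ W) (v : V) : v ∈ W := by
  let e := Module.finBasis k A
  let e' := Module.finBasis k B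
  -- The action of A multiplies the argument on the right, hence the flipped trace map; B multiplies
  -- on the left and needs no flip.
  choose a ha using fun i => hA.flip_bijective.2 (e.coord i)
  choose b hb using fun j => hB.2 (e'.coord j)
  have h : v = ∑ i, ∑ j, v (e i) (e' j) •
      bilinLact A B (a i) (bilinRact A B (lA.smulRight lB) (b j)) := by
    refine e.ext fun i => e'.ext fun j => ?_
    have hij : ∀ m n, bilinLact A B (a m) (bilinRact A B (lA.smulRight lB) (b n)) (e i) (e' j) =
        (if i = m then 1 else 0) * (if j = n then 1 else 0) := by
      intro m n
      have ha' : lA (e i * a m) = e.coord m (e i) := LinearMap.congr_fun (ha m) (e i)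
      have hb' : lB (b n * e' j) = e'.coord n (e' j) := LinearMap.congr_fun (hb n) (e' j)
      change lA (e i * a m) * lB (b n * e' j) = _
      rw [ha', hb', Module.Basis.coord_apply, Module.Basis.coord_apply, e.repr_self,
        e'.repr_self, Finsupp.single_apply, Finsupp.single_apply]
    simp only [LinearMap.sum_apply, LinearMap.smul_apply, hij]
    simp
  rw [h]
  exact Submodule.sum_mem _ fun i _ => Submodule.sum_mem _ fun j _ => Submodule.smul_mem _ _ (hW _ _)

/-- Untwists the diagonal action: (h S(b_{(-1)}) ⊗ v) b_{(0)} = h ⊗ v b. -/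
theorem sum_cofreeRact_tmul [LeftComoduleAlgebra k H B] {ι : Type*} [Fintype ι]
    (e : Module.Basis ι k B) (h : H) (v : V) (i : ι) :
    ∑ j, cofreeRact k H A B ((h * HopfAlgebra.antipode k (matrixCoeff
      (LeftComoduleAlgebra.coaction (k := k) (H := H)).toLinearMap e i j)) ⊗ₜ v) (e j) =
        h ⊗ₜ bilinRact A B v (e i) := by
  classical
  have h1 : ∀ (y : H) j, cofreeRact k H A B (y ⊗ₜ v) (e j) = ∑ l, (y * matrixCoeff
      (LeftComoduleAlgebra.coaction (k := k) (H := H)).toLinearMap e j l) ⊗ₜ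
        bilinRact A B v (e l) := by
    intro y j
    rw [cofreeRact, LinearMap.compl₂_apply, coaction_basis _ e j]
    simp
  simp only [h1]
  rw [Finset.sum_comm]
  simp only [← TensorProduct.sum_tmul, mul_assoc, ← Finset.mul_sum,
    LeftComoduleAlgebra.isLeftCoaction.sum_antipode_mul_matrixCoeff e, mul_ite, mul_one, mul_zero,
    TensorProduct.ite_tmul, Finset.sum_ite_eq, Finset.mem_univ, if_true]

/-- The mirror identity a_{(0)} (S⁻¹(a_{(-1)}) h ⊗ v) = h ⊗ a v, with T as S⁻¹. On this side the
inverse antipode is needed, and the cancellation is checked after applying the injective S. -/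
theorem sum_cofreeLact_tmul [LeftComoduleAlgebra k H A] {ι : Type*} [Fintype ι]
    {T : H → H} (hS : Function.Injective (HopfAlgebra.antipode k (A := H)))
    (hT : ∀ h, HopfAlgebra.antipode k (T h) = h)
    (e : Module.Basis ι k A) (h : H) (v : V) (i : ι) :
    ∑ j, cofreeLact k H A B (e j) ((T (matrixCoeff
      (LeftComoduleAlgebra.coaction (k := k) (H := H)).toLinearMap e i j) * h) ⊗ₜ v) =
        h ⊗ₜ bilinLact A B (e i) v := by
  classical
  have h1 : ∀ (y : H) j, cofreeLact k H A B (e j) (y ⊗ₜ v) = ∑ l, (matrixCoeff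
      (LeftComoduleAlgebra.coaction (k := k) (H := H)).toLinearMap e j l * y) ⊗ₜ
        bilinLact A B (e l) v := by
    intro y j
    rw [cofreeLact, LinearMap.comp_apply, coaction_basis _ e j]
    simp
  have h2 : ∀ l, ∑ j, matrixCoeff (LeftComoduleAlgebra.coaction (k := k) (H := H)).toLinearMap e j l *
      T (matrixCoeff (LeftComoduleAlgebra.coaction (k := k) (H := H)).toLinearMap e i j) =
        if i = l then 1 else 0 := by
    intro l
    apply hS
    rw [map_sum]
    simp only [HopfAlgebra.antipode_mul_antidistrib, hT,
      LeftComoduleAlgebra.isLeftCoaction.sum_matrixCoeff_mul_antipode e]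
    split_ifs <;> simp
  simp only [h1]
  rw [Finset.sum_comm]
  simp only [← TensorProduct.sum_tmul, ← mul_assoc, ← Finset.sum_mul, h2, ite_mul, one_mul,
    zero_mul, TensorProduct.ite_tmul, Finset.sum_ite_eq, Finset.mem_univ, if_true]

variable [LeftComoduleAlgebra k H A] [LeftComoduleAlgebra k H B]

variable (H) in
/-- The map `a ⊗ h ⊗ b ↦ a (h ⊗ (lA ⊗ lB)) b` into the cofree object. -/
noncomputable def cofreeOrbit (lA : Module.Dual k A) (lB : Module.Dual k B) :
    (A ⊗[k] H) ⊗[k] B →ₗ[k] H ⊗[k] V :=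
  orbitMap (cofreeLact k H A B) (cofreeRact k H A B)
    ((TensorProduct.mk k H V).flip (lA.smulRight lB))

theorem cofreeOrbit_tmul (lA : Module.Dual k A) (lB : Module.Dual k B) (a : A) (h : H) (b : B) :
    cofreeOrbit H lA lB ((a ⊗ₜ h) ⊗ₜ b) =
      cofreeRact k H A B (cofreeLact k H A B a (h ⊗ₜ lA.smulRight lB)) b := rfl

variable [FiniteDimensional k H] [FiniteDimensional k A] [FiniteDimensional k B]
  {lA : Module.Dual k A} {lB : Module.Dual k B} (hA : IsFrobeniusTrace lA)
  (hB : IsFrobeniusTrace lB) (hS : Function.Injective (HopfAlgebra.antipode k (A := H)))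
include hA hB hS

theorem cofreeOrbit_surjective : Function.Surjective (cofreeOrbit H lA lB) := by
  obtain ⟨T, hT⟩ := (LinearMap.injective_iff_surjective.1 hS).hasRightInverse
  let e := Module.finBasis k A
  let e' := Module.finBasis k B
  have h1 : ∀ h i j, h ⊗ₜ[k] bilinLact A B (e i) (bilinRact A B (lA.smulRight lB) (e' j)) ∈
      LinearMap.range (cofreeOrbit H lA lB) := by
    intro h i j
    rw [← sum_cofreeLact_tmul hS hT]
    refine Submodule.sum_mem _ fun m _ => ?_
    rw [← sum_cofreeRact_tmul, map_sum]
    refine Submodule.sum_mem _ fun n _ => ?_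
    exact ⟨(e m ⊗ₜ _) ⊗ₜ e' n, map₂_bilinLact_bilinRact _ _ _⟩
  have h2 : ∀ h a b, h ⊗ₜ[k] bilinLact A B a (bilinRact A B (lA.smulRight lB) b) ∈
      LinearMap.range (cofreeOrbit H lA lB) := by
    intro h a b
    rw [← e.sum_repr a, ← e'.sum_repr b]
    simp only [map_sum, map_smul, LinearMap.sum_apply, LinearMap.smul_apply,
      TensorProduct.tmul_sum, TensorProduct.tmul_smul]
    exact Submodule.sum_mem _ fun j _ => Submodule.smul_mem _ _ <|
      Submodule.sum_mem _ fun i _ => Submodule.smul_mem _ _ (h1 h i j)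
  intro t
  induction t with
  | zero => exact ⟨0, map_zero _⟩
  | add x y hx hy =>
    obtain ⟨x, rfl⟩ := hx
    obtain ⟨y, rfl⟩ := hy
    exact ⟨x + y, map_add _ _ _⟩
  | tmul h v =>
    exact hA.exists_sum_bilin hB
      ((LinearMap.range (cofreeOrbit H lA lB)).comap (TensorProduct.mk k H V h)) (h2 h) v

/-- Both sides have dimension dim A · dim H · dim B, so surjectivity is enough. -/
theorem cofreeOrbit_bijective : Function.Bijective (cofreeOrbit H lA lB) := by
  have hs := cofreeOrbit_surjective hA hB hS
  refine ⟨(LinearMap.injective_iff_surjective_of_finrank_eq_finrank ?_).2 hs, hs⟩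
  simp only [Module.finrank_tensorProduct, Module.finrank_linearMap, Module.finrank_self]
  ring

end CofreeOrbit

/-! ### Morphisms determined on orbits -/

section OrbitHom

variable {k H A B : Type u} [Field k] [Ring H] [HopfAlgebra k H]
  [Ring A] [Algebra k A] [Ring B] [Algebra k B]
  [LeftComoduleAlgebra k H A] [LeftComoduleAlgebra k H B]

/-- A linear map that sends `a σ(h) b` to `a ρ(h) b` for colinear `σ` and `ρ` is compatible with
the structure maps. -/
theorem IsRelHopfBimodHom.of_orbitMap {Y X : RelHopfBimodData k H A B} (hY : IsRelHopfBimod Y)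
    (hX : IsRelHopfBimod X) {σ : H →ₗ[k] Y.carrier} {ρ : H →ₗ[k] X.carrier}
    {f : Y.carrier →ₗ[k] X.carrier} (hs : Function.Surjective (orbitMap Y.lact Y.ract σ))
    (hf : f ∘ₗ orbitMap Y.lact Y.ract σ = orbitMap X.lact X.ract ρ)
    (hσ : ∀ h, Y.coact (σ h) = σ.lTensor H (Coalgebra.comul (R := k) h))
    (hρ : ∀ h, X.coact (ρ h) = ρ.lTensor H (Coalgebra.comul (R := k) h)) :
    IsRelHopfBimodHom Y X f := by
  have hf' : ∀ a h b, f (Y.ract (Y.lact a (σ h)) b) = X.ract (X.lact a (ρ h)) b := fun a h b =>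
    LinearMap.congr_fun hf ((a ⊗ₜ h) ⊗ₜ b)
  have hlact : ∀ a y, f (Y.lact a y) = X.lact a (f y) := by
    intro a y
    refine LinearMap.congr_fun (f := f ∘ₗ Y.lact a) (g := X.lact a ∘ₗ f)
      ((LinearMap.cancel_right hs).1 (TensorProduct.ext_threefold fun a' h b => ?_)) y
    simp only [LinearMap.comp_apply, orbitMap_tmul, hf']
    rw [← hY.lact_ract, ← hY.mul_lact, hf', hX.mul_lact, hX.lact_ract]
  have hract : ∀ y b, f (Y.ract y b) = X.ract (f y) b := by
    intro y b
    refine LinearMap.congr_fun (f := f ∘ₗ Y.ract.flip b) (g := X.ract.flip b ∘ₗ f)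
      ((LinearMap.cancel_right hs).1 (TensorProduct.ext_threefold fun a h b' => ?_)) y
    simp only [LinearMap.comp_apply, orbitMap_tmul, LinearMap.flip_apply, hf']
    rw [← hY.ract_mul, hf', hX.ract_mul]
  have hfσ : f ∘ₗ σ = ρ := LinearMap.ext fun h => by
    simpa [hY.one_lact, hY.ract_one, hX.one_lact, hX.ract_one] using hf' 1 h 1
  refine ⟨fun y => ?_, hlact, hract⟩
  -- Both coactions are compatible with the actions, so colinearity on orbits reduces to colinearity
  -- on the image of σ.
  refine LinearMap.congr_fun (f := X.coact ∘ₗ f) (g := f.lTensor H ∘ₗ Y.coact)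
    ((LinearMap.cancel_right hs).1 (TensorProduct.ext_threefold fun a h b => ?_)) y
  simp only [LinearMap.comp_apply, orbitMap_tmul]
  have h1 : X.coact (f (σ h)) = f.lTensor H (Y.coact (σ h)) := by
    rw [hσ, ← LinearMap.comp_apply, ← LinearMap.comp_apply (f.lTensor H), ← LinearMap.lTensor_comp,
      hfσ, ← hρ, ← hfσ]
    rfl
  rw [hract, hlact, hX.coact_ract, hX.coact_lact, h1, hY.coact_ract, hY.coact_lact,
    TensorProduct.map₂_lTensor_right _ _ _ f f hlact,
    TensorProduct.map₂_lTensor_left _ _ _ f f fun b m => hract m b]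

end OrbitHom

/-! ### Colinear maps out of H built from a cointegral -/

section CointegralOrbit

open HopfAlgebra (antipode)
open Coalgebra (comul)

variable {k H M : Type u} [Field k] [Ring H] [HopfAlgebra k H] [AddCommGroup M] [Module k M]

/-- The map `x ↦ (h ↦ l(S(h) x_{(-1)}) x_{(0)})`. -/
noncomputable def cointegralOrbit (l : Module.Dual k H) (δ : M →ₗ[k] H ⊗[k] M) :
    M →ₗ[k] H →ₗ[k] M :=
  (((LinearMap.rTensorHom M).compr₂ (TensorProduct.lid k M).toLinearMap) ∘ₗ
    traceMap l ∘ₗ antipode k).flip ∘ₗ δ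

theorem cointegralOrbit_apply (l : Module.Dual k H) (δ : M →ₗ[k] H ⊗[k] M) (x : M) (h : H) :
    cointegralOrbit l δ x h = evalLeft M (l ∘ₗ LinearMap.mulLeft k (antipode k h)) (δ x) := rfl

/-- Colinearity of h ↦ l(S(h) x_{(-1)}) x_{(0)} is the shift identity l(S(h) y₁) y₂ = h₁ l(S(h₂) y),
applied with y a matrix coefficient of δ. -/
theorem IsRightCointegral.coaction_cointegralOrbit [FiniteDimensional k H] [FiniteDimensional k M]
    {l : Module.Dual k H} (hl : IsRightCointegral l) {δ : M →ₗ[k] H ⊗[k] M}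
    (hδ : IsLeftCoaction δ) (x : M) (h : H) :
    δ (cointegralOrbit l δ x h) = (cointegralOrbit l δ x).lTensor H (comul (R := k) h) := by
  let e := Module.finBasis k M
  refine LinearMap.congr_fun (f := δ ∘ₗ (cointegralOrbit l δ).flip h)
    (g := (LinearMap.lTensorHom H ∘ₗ cointegralOrbit l δ).flip (comul (R := k) h))
    (e.ext fun i => ?_) x
  have hr : ∀ y, cointegralOrbit l δ (e i) y =
      ∑ j, l (antipode k y * matrixCoeff δ e i j) • e j := by
    intro y
    rw [cointegralOrbit_apply, coaction_basis δ e i]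
    simp
  have h1 : ∀ w : H ⊗[k] H, (cointegralOrbit l δ (e i)).lTensor H w = ∑ j,
      evalRight H (l ∘ₗ LinearMap.mulRight k (matrixCoeff δ e i j) ∘ₗ antipode k) w ⊗ₜ e j := by
    intro w
    induction w with
    | zero => simp
    | add x y hx hy =>
      simp only [map_add, TensorProduct.add_tmul, Finset.sum_add_distrib, hx, hy]
    | tmul x y =>
      simp [hr, TensorProduct.tmul_sum, TensorProduct.smul_tmul']
  change δ (cointegralOrbit l δ (e i) h) = (cointegralOrbit l δ (e i)).lTensor H _
  rw [h1, hr]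
  simp only [← hl.antipode_shift, hδ.comul_matrixCoeff e, map_sum, map_smul, evalLeft_tmul,
    coaction_basis δ e, Finset.smul_sum, TensorProduct.sum_tmul, TensorProduct.smul_tmul',
    LinearMap.comp_apply, LinearMap.mulLeft_apply]
  exact Finset.sum_comm

/-- By the shift identity, l(S(h) p₁) p₂ = h₁ l(S(h₂) p) = h₁ ε(h₂) l(p) = h. Thus p ⊗ v determines
all h ⊗ v. -/
theorem IsRightCointegral.cointegralOrbit_integral [FiniteDimensional k H] {A B : Type u} [Ring A]
    [Algebra k A] [Ring B] [Algebra k B] {l : Module.Dual k H} (hl : IsRightCointegral l) {p : H}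
    (hp : IsLeftIntegral (k := k) p) (hlp : l p = 1) (v : A →ₗ[k] B →ₗ[k] k) (h : H) :
    cointegralOrbit l (cofreeCoact k H A B) (p ⊗ₜ v) h = h ⊗ₜ v := by
  rw [cointegralOrbit_apply, cofree_coact_tmul, evalLeft_lTensor, hl.antipode_shift]
  have h1 : l ∘ₗ LinearMap.mulRight k p ∘ₗ antipode k = Coalgebra.counit (R := k) := by
    ext x
    simp [hp (antipode k x), hlp]
  rw [h1]
  simp [evalRight]

end CointegralOrbit

/-! ### H ⊗ V as a Frobenius generator -/

section CofreeGenerator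

open HopfAlgebra (antipode)
open Coalgebra (comul counit)
open RelHopfBimod

variable {k H A B : Type u} [Field k] [Ring H] [HopfAlgebra k H]
  [Ring A] [Algebra k A] [Ring B] [Algebra k B]
  [LeftComoduleAlgebra k H A] [LeftComoduleAlgebra k H B]
  [FiniteDimensional k H] [FiniteDimensional k A] [FiniteDimensional k B]
  {l : Module.Dual k H} (hl : IsRightCointegral l) (hl0 : l ≠ 0)
  {lA : Module.Dual k A} {lB : Module.Dual k B} (hA : IsFrobeniusTrace lA)
  (hB : IsFrobeniusTrace lB)

local notation "V" => A →ₗ[k] B →ₗ[k] k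

/-- The isomorphism `a ⊗ h ⊗ b ↦ a (h ⊗ (lA ⊗ lB)) b`. -/
noncomputable def cofreeOrbitEquiv : ((A ⊗[k] H) ⊗[k] B) ≃ₗ[k] H ⊗[k] V :=
  LinearEquiv.ofBijective (cofreeOrbit H lA lB)
    (cofreeOrbit_bijective hA hB (hl.antipode_injective hl0))

/-- The linear map `a (h ⊗ (lA ⊗ lB)) b ↦ a l(S(h) x_{(-1)}) x_{(0)} b`. -/
noncomputable def fromCofree (X : RelHopfBimodData k H A B) (x : X.carrier) :
    H ⊗[k] V →ₗ[k] X.carrier :=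
  orbitMap X.lact X.ract (cointegralOrbit l X.coact x) ∘ₗ
    (cofreeOrbitEquiv hl hl0 hA hB).symm.toLinearMap

theorem fromCofree_comp (X : RelHopfBimodData k H A B) (x : X.carrier) :
    fromCofree hl hl0 hA hB X x ∘ₗ cofreeOrbit H lA lB =
      orbitMap X.lact X.ract (cointegralOrbit l X.coact x) :=
  LinearMap.ext fun t => congrArg (orbitMap X.lact X.ract (cointegralOrbit l X.coact x))
    ((cofreeOrbitEquiv hl hl0 hA hB).symm_apply_apply t)

theorem fromCofree_orbit (X : RelHopfBimodData k H A B) (x : X.carrier) (a : A) (h : H) (b : B) :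
    fromCofree hl hl0 hA hB X x (cofreeOrbit H lA lB ((a ⊗ₜ h) ⊗ₜ b)) =
      X.ract (X.lact a (cointegralOrbit l X.coact x h)) b :=
  LinearMap.congr_fun (fromCofree_comp hl hl0 hA hB X x) _

theorem fromCofree_tmul {X : RelHopfBimodData k H A B} (hX : IsRelHopfBimod X) (x : X.carrier)
    (h : H) : fromCofree hl hl0 hA hB X x (h ⊗ₜ lA.smulRight lB) = cointegralOrbit l X.coact x h := by
  have := fromCofree_orbit hl hl0 hA hB X x 1 h 1
  rwa [cofreeOrbit_tmul, cofreeLact_one, cofreeRact_one, hX.one_lact, hX.ract_one] at this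

theorem isRelHopfBimodHom_fromCofree {X : RelHopfBimodData k H A B} (hX : IsRelHopfBimod X)
    (x : X.carrier) :
    IsRelHopfBimodHom (cofreeData k H A B) X (fromCofree hl hl0 hA hB X x) :=
  .of_orbitMap (isRelHopfBimod_cofree k H A B) hX (cofreeOrbitEquiv hl hl0 hA hB).surjective
    (fromCofree_comp hl hl0 hA hB X x) (fun h => cofree_coact_tmul h _)
    (hl.coaction_cointegralOrbit hX.isLeftCoaction x)

/-- The morphism out of the cofree object that corresponds to an element. -/
noncomputable def fromCofreeHom (X : RelHopfBimod k H A B) :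
    X.toData.carrier →ₗ[k] (cofreeObj k H A B ⟶ X) where
  toFun x := homMk (M := cofreeObj k H A B) (fromCofree hl hl0 hA hB X.toData x)
    (isRelHopfBimodHom_fromCofree hl hl0 hA hB X.isRelHopfBimod x)
  map_add' x y := toLin_injective <| by
    refine (LinearMap.cancel_right (cofreeOrbitEquiv hl hl0 hA hB).surjective).1
      (TensorProduct.ext_threefold fun a h b => ?_)
    refine (fromCofree_orbit hl hl0 hA hB X.toData (x + y) a h b).trans ?_
    rw [map_add, LinearMap.add_apply, map_add, map_add, LinearMap.add_apply]
    exact congrArg₂ (· + ·) (fromCofree_orbit hl hl0 hA hB X.toData x a h b).symm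
      (fromCofree_orbit hl hl0 hA hB X.toData y a h b).symm
  map_smul' c x := toLin_injective <| by
    refine (LinearMap.cancel_right (cofreeOrbitEquiv hl hl0 hA hB).surjective).1
      (TensorProduct.ext_threefold fun a h b => ?_)
    refine (fromCofree_orbit hl hl0 hA hB X.toData (c • x) a h b).trans ?_
    rw [map_smul, LinearMap.smul_apply, map_smul, map_smul, LinearMap.smul_apply]
    exact congrArg (c • ·) (fromCofree_orbit hl hl0 hA hB X.toData x a h b).symm

section

variable {p : H} (hp : IsLeftIntegral (k := k) p) (hlp : l p = 1)

include hl hl0 hA hB hp hlp in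
-- A colinear f commutes with the formation of l(S(h) x_{(-1)}) x_{(0)}, so its value at p ⊗ (lA ⊗
-- lB) fixes its value at every h ⊗ (lA ⊗ lB). Bilinearity over A and B then fixes it on all orbits.
theorem hom_ext_cofree {X : RelHopfBimodData k H A B} {f g : H ⊗[k] V →ₗ[k] X.carrier}
    (hf : IsRelHopfBimodHom (cofreeData k H A B) X f)
    (hg : IsRelHopfBimodHom (cofreeData k H A B) X g)
    (h : f (p ⊗ₜ lA.smulRight lB) = g (p ⊗ₜ lA.smulRight lB)) : f = g := by
  have key : ∀ f : H ⊗[k] V →ₗ[k] X.carrier, IsRelHopfBimodHom (cofreeData k H A B) X f →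
      f ∘ₗ cofreeOrbit H lA lB = orbitMap X.lact X.ract
        (cointegralOrbit l X.coact (f (p ⊗ₜ lA.smulRight lB))) := by
    intro f hf
    refine TensorProduct.ext_threefold fun a h b => ?_
    refine (hf.ract _ b).trans (congrArg (fun m => X.ract m b) ?_)
    refine (hf.lact a _).trans (congrArg (X.lact a) ?_)
    refine (congrArg f (hl.cointegralOrbit_integral hp hlp _ h).symm).trans ?_
    exact (evalLeft_lTensor _ f _).symm.trans (congrArg _ (hf.coact _).symm)
  refine (LinearMap.cancel_right (cofreeOrbitEquiv hl hl0 hA hB).surjective).1 ?_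
  exact (key f hf).trans (h ▸ (key g hg).symm)

variable (hp' : ∀ y, l (antipode k p * y) = counit (R := k) y)

/-- The cofree object is a Frobenius generator. -/
noncomputable def cofreeGenerator : FrobeniusGenerator k H A B where
  obj := cofreeObj k H A B
  gen := p ⊗ₜ[k] lA.smulRight lB
  form := cofreeForm k H A B
  fromGen := fromCofreeHom hl hl0 hA hB
  fromGen_gen X x := by
    refine (fromCofree_tmul hl hl0 hA hB X.isRelHopfBimod x p).trans ?_
    -- The second normalization of p is used here: l(S(p) x_{(-1)}) x_{(0)} = ε(x_{(-1)}) x_{(0)} =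
    -- x.
    have h1 : l ∘ₗ LinearMap.mulLeft k (antipode k p) = counit (R := k) := by ext y; simp [hp']
    rw [cointegralOrbit_apply, h1, X.isRelHopfBimod.isLeftCoaction.evalLeft_counit]
  hom_ext_gen _ g g' h := toLin_injective <| hom_ext_cofree hl hl0 hA hB hp hlp
    (isRelHopfBimodHom_toLin g) (isRelHopfBimodHom_toLin g') h
  coform := cofreeCoformHom
  form_coform M ξ m := M.isRelHopfBimod.cofreeForm_cofreeCoform ξ m
  hom_ext_form _ g g' h := toLin_injective <|
    cofree_hom_ext (isRelHopfBimodHom_toLin g) (isRelHopfBimodHom_toLin g') h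

end

/-- The master formula for the twists: each of the three comes from inserting the generator moved by
one structure map as y. -/
theorem cofreeForm_fromCofree (y : H ⊗[k] V) (a : A) (h : H) (b : B) :
    cofreeForm k H A B (fromCofree hl hl0 hA hB (cofreeData k H A B) y
      (cofreeOrbit H lA lB ((a ⊗ₜ h) ⊗ₜ b))) =
        evalLeft V (l ∘ₗ LinearMap.mulLeft k (antipode k h)) y a b := by
  refine (congrArg (cofreeForm k H A B)
    (fromCofree_orbit hl hl0 hA hB (cofreeData k H A B) y a h b)).trans ?_
  refine (cofreeForm_lact_ract a b _).trans ?_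
  exact congrArg (fun v : V => v a b) (evalLeft_counit_evalLeft_cofreeCoact _ y)

end CofreeGenerator

/-! ### Computation of the three twists -/

section CofreeTwist

open HopfAlgebra (antipode)
open Coalgebra (comul counit)
open RelHopfBimod

variable {k H A B : Type u} [Field k] [Ring H] [HopfAlgebra k H]
  [Ring A] [Algebra k A] [Ring B] [Algebra k B]

local notation "V" => A →ₗ[k] B →ₗ[k] k

theorem evalLeft_map₂_bilinLact_tmul (φ : Module.Dual k H) (z : H ⊗[k] A) (h : H) (v : V) :
    evalLeft V φ (TensorProduct.map₂ (LinearMap.mul k H) (bilinLact A B) z (h ⊗ₜ v)) =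
      bilinLact A B (evalLeft A (φ ∘ₗ LinearMap.mulRight k h) z) v := by
  induction z with
  | zero => simp
  | add x y hx hy => simp only [map_add, LinearMap.add_apply, hx, hy]
  | tmul x a => simp

theorem evalLeft_map₂_bilinRact_tmul (φ : Module.Dual k H) (z : H ⊗[k] B) (h : H) (v : V) :
    evalLeft V φ (TensorProduct.map₂ (LinearMap.mul k H) (bilinRact A B) (h ⊗ₜ v) z) =
      bilinRact A B v (evalLeft B (φ ∘ₗ LinearMap.mulLeft k h) z) := by
  induction z with
  | zero => simp
  | add x y hx hy => simp only [map_add, hx, hy]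
  | tmul x a => simp

theorem evalLeft_map₂_map₂_smulRight (φ : Module.Dual k H) (lA : Module.Dual k A)
    (lB : Module.Dual k B) (z : H ⊗[k] A) (h : H) (w : H ⊗[k] B) :
    evalLeft V φ (TensorProduct.map₂ (LinearMap.mul k H) (bilinRact A B)
      (TensorProduct.map₂ (LinearMap.mul k H) (bilinLact A B) z (h ⊗ₜ lA.smulRight lB)) w) 1 1 =
        φ (evalRight H lA z * h * evalRight H lB w) := by
  induction z with
  | zero => simp
  | add x y hx hy => simp only [map_add, LinearMap.add_apply, hx, hy, add_mul]
  | tmul x a =>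
    induction w with
    | zero => simp
    | add x y hx hy => simp only [map_add, LinearMap.add_apply, hx, hy, mul_add]
    | tmul y b => simp [mul_comm, mul_assoc]

/-- S² is multiplicative and fixes grouplikes, so the outer factors cancel. -/
theorem coactionTwist_mul_mul (gA gB : GroupLike k H) (gH h : H) :
    coactionTwist gA gB gH (gA * h * gB) = antipode k (antipode k h) * gH := by
  change ((gA⁻¹ : GroupLike k H) : H) * (antipode k (antipode k (gA * h * gB)) *
    (((gB⁻¹ : GroupLike k H) : H) * gH)) = _
  simp only [HopfAlgebra.antipode_mul_antidistrib, gA.2.antipode_antipode, gB.2.antipode_antipode,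
    GroupLike.val_inv, mul_assoc]
  rw [← mul_assoc, gA.2.antipode_mul_cancel, one_mul, ← mul_assoc (gB : H),
    gB.2.mul_antipode_cancel, one_mul]

theorem IsLeftCoaction.evalLeft_smul_counit {M : Type u} [AddCommGroup M] [Module k M]
    {δ : M →ₗ[k] H ⊗[k] M} (hδ : IsLeftCoaction δ) (c : k) (m : M) :
    evalLeft M (c • Coalgebra.counit (R := k)) (δ m) = c • m := by
  conv_rhs => rw [← hδ.evalLeft_counit m]
  simp [evalLeft, LinearMap.rTensor_smul]

variable [LeftComoduleAlgebra k H A] [LeftComoduleAlgebra k H B]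
  [FiniteDimensional k H] [FiniteDimensional k A] [FiniteDimensional k B]
  {l : Module.Dual k H} (hl : IsRightCointegral l) (hl0 : l ≠ 0)
  {lA : Module.Dual k A} {lB : Module.Dual k B} (hA : IsFrobeniusTrace lA)
  (hB : IsFrobeniusTrace lB) {p : H} (hp : IsLeftIntegral (k := k) p) (hlp : l p = 1)

theorem cofreeForm_fromCofree_eq {y : H ⊗[k] V} {g : Module.Dual k (H ⊗[k] V)}
    (hg : ∀ a h b, evalLeft V (l ∘ₗ LinearMap.mulLeft k (antipode k h)) y a b =
      g (cofreeOrbit H lA lB ((a ⊗ₜ h) ⊗ₜ b))) (q : H ⊗[k] V) :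
    cofreeForm k H A B (fromCofree hl hl0 hA hB (cofreeData k H A B) y q) = g q := by
  let f : H ⊗[k] V →ₗ[k] H ⊗[k] V := fromCofree hl hl0 hA hB (cofreeData k H A B) y
  refine LinearMap.congr_fun (f := cofreeForm k H A B ∘ₗ f) (g := g)
    ((LinearMap.cancel_right (cofreeOrbitEquiv hl hl0 hA hB).surjective).1
      (TensorProduct.ext_threefold fun a h b => ?_)) q
  exact (cofreeForm_fromCofree hl hl0 hA hB y a h b).trans (hg a h b)

omit [FiniteDimensional k H] [FiniteDimensional k A] [FiniteDimensional k B] in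
theorem cofreeForm_orbit (a : A) (h : H) (b : B) :
    cofreeForm k H A B (cofreeOrbit H lA lB ((a ⊗ₜ h) ⊗ₜ b)) =
      counit (R := k) h * (lA a * lB b) := by
  rw [cofreeOrbit_tmul, cofreeForm_lact_ract]
  simp

omit [FiniteDimensional k H] [FiniteDimensional k A] [FiniteDimensional k B] in
theorem cofreeLact_orbit (a' a : A) (h : H) (b : B) :
    cofreeLact k H A B a' (cofreeOrbit H lA lB ((a ⊗ₜ h) ⊗ₜ b)) =
      cofreeOrbit H lA lB (((a' * a) ⊗ₜ h) ⊗ₜ b) := by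
  rw [cofreeOrbit_tmul, cofreeOrbit_tmul, cofreeLact_mul]
  exact (map₂_bilinLact_bilinRact _ _ _).symm

omit [FiniteDimensional k H] [FiniteDimensional k A] [FiniteDimensional k B] in
theorem cofreeRact_orbit (a : A) (h : H) (b b' : B) :
    cofreeRact k H A B (cofreeOrbit H lA lB ((a ⊗ₜ h) ⊗ₜ b)) b' =
      cofreeOrbit H lA lB ((a ⊗ₜ h) ⊗ₜ (b * b')) := by
  rw [cofreeOrbit_tmul, cofreeOrbit_tmul, cofreeRact_mul]

include hp hlp

/-- At q = a' (h ⊗ (lA ⊗ lB)) b, the left integral gives l(S(h) x p) = ε(h) ε(x). Both sides become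
ε(h) lA(a' a) lB(b), the right one after lA(ν(a) a') = lA(a' a). -/
theorem cofreeForm_fromCofree_lact (a : A) (q : H ⊗[k] V) :
    cofreeForm k H A B (fromCofree hl hl0 hA hB (cofreeData k H A B)
      (cofreeLact k H A B a (p ⊗ₜ lA.smulRight lB)) q) =
        cofreeForm k H A B (cofreeLact k H A B (nakayamaAut hA a) q) := by
  refine cofreeForm_fromCofree_eq hl hl0 hA hB
    (g := cofreeForm k H A B ∘ₗ cofreeLact k H A B (nakayamaAut hA a)) (fun a' h b => ?_) q
  have h1 : (l ∘ₗ LinearMap.mulLeft k (antipode k h)) ∘ₗ LinearMap.mulRight k p =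
      counit (R := k) h • counit (R := k) := by
    ext x
    simp [hp x, hp (antipode k h), hlp, mul_comm]
  rw [LinearMap.comp_apply, cofreeLact_orbit, cofreeForm_orbit, ← nakayamaAut_spec hA, cofreeLact,
    LinearMap.comp_apply, evalLeft_map₂_bilinLact_tmul, h1,
    LeftComoduleAlgebra.isLeftCoaction.evalLeft_smul_counit]
  simp

/-- Now the coaction of b stands to the right of p, and l(S(h) p x) = ε(h) α(x) produces b ↼ α. It
appears on the left inside lB; moving it to the right costs the inverse Nakayama automorphism. -/
theorem cofreeForm_fromCofree_ract {α : Module.Dual k H} (hα : ∀ h, p * h = α h • p) (b : B)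
    (q : H ⊗[k] V) :
    cofreeForm k H A B (fromCofree hl hl0 hA hB (cofreeData k H A B)
      (cofreeRact k H A B (p ⊗ₜ lA.smulRight lB) b) q) =
        cofreeForm k H A B (cofreeRact k H A B q ((nakayamaAut hB).symm
          (harpoon (LeftComoduleAlgebra.coaction (k := k) (H := H)).toLinearMap α b))) := by
  refine cofreeForm_fromCofree_eq hl hl0 hA hB
    (g := cofreeForm k H A B ∘ₗ (cofreeRact k H A B).flip _) (fun a h b' => ?_) q
  have h1 : (l ∘ₗ LinearMap.mulLeft k (antipode k h)) ∘ₗ LinearMap.mulLeft k p =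
      counit (R := k) h • α := by
    ext x
    simp [hα, hp (antipode k h), hlp, mul_comm]
  rw [LinearMap.comp_apply, LinearMap.flip_apply, cofreeRact_orbit, cofreeForm_orbit,
    nakayamaAut_spec hB, LinearEquiv.apply_symm_apply, cofreeRact,
    LinearMap.compl₂_apply, evalLeft_map₂_bilinRact_tmul, h1, harpoon_apply]
  simp [evalLeft, LinearMap.rTensor_smul]

/-- With y = χ(p₁) p₂ ⊗ (lA ⊗ lB), the left side is lA(a) lB(b) χ(S²(h) gH). On the right,
contracting the coaction of a (h ⊗ (lA ⊗ lB)) b with the form gives lA(a) lB(b) gA h gB, which the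
twist sends to the same element. -/
theorem cofreeForm_fromCofree_coact {gH : H} {gA gB : GroupLike k H}
    (hgH : ∀ h : H, contractCoaction (comul (R := k) (A := H)) l h = l h • gH)
    (hgA : IsGCointegral gA lA) (hgB : IsGCointegral gB lB) (χ : Module.Dual k H)
    (q : H ⊗[k] V) :
    cofreeForm k H A B (fromCofree hl hl0 hA hB (cofreeData k H A B)
      (evalLeft (H ⊗[k] V) χ (cofreeCoact k H A B (p ⊗ₜ lA.smulRight lB))) q) =
        cofreeForm k H A B (evalLeft (H ⊗[k] V) (χ ∘ₗ coactionTwist gA gB gH)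
          (cofreeCoact k H A B q)) := by
  refine cofreeForm_fromCofree_eq hl hl0 hA hB (g := cofreeForm k H A B ∘ₗ
    evalLeft (H ⊗[k] V) (χ ∘ₗ coactionTwist gA gB gH) ∘ₗ cofreeCoact k H A B) (fun a h b => ?_) q
  have hA' : evalRight H lA ((LeftComoduleAlgebra.coaction (k := k) (H := H)).toLinearMap a) =
    lA a • (gA : H) := hgA a
  have hB' : evalRight H lB ((LeftComoduleAlgebra.coaction (k := k) (H := H)).toLinearMap b) =
    lB b • (gB : H) := hgB b
  rw [evalLeft_cofreeCoact, evalLeft_tmul, LinearMap.comp_apply, LinearMap.comp_apply,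
    LinearMap.comp_apply, LinearMap.comp_apply, hp.evalRight_comul_eq hlp hgH,
    cofreeForm_evalLeft_cofreeCoact, cofreeOrbit_tmul, cofreeRact, LinearMap.compl₂_apply,
    cofreeLact, LinearMap.comp_apply, evalLeft_map₂_map₂_smulRight, hA', hB', LinearMap.comp_apply,
    smul_mul_assoc, smul_mul_smul_comm, map_smul, coactionTwist_mul_mul]
  simp [mul_comm]

theorem cofreeGenerator_isTwistedBy (hp' : ∀ y, l (antipode k p * y) = counit (R := k) y)
    {gH : H} {gA gB : GroupLike k H}
    (hgH : ∀ h : H, contractCoaction (comul (R := k) (A := H)) l h = l h • gH)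
    (hgA : IsGCointegral gA lA) (hgB : IsGCointegral gB lB)
    {α : Module.Dual k H} (hα : ∀ h, p * h = α h • p) :
    (cofreeGenerator hl hl0 hA hB hp hlp hp').IsTwistedBy gA gB gH α
      (nakayamaAut hA) (nakayamaAut hB) where
  lact := cofreeForm_fromCofree_lact hl hl0 hA hB hp hlp
  ract := cofreeForm_fromCofree_ract hl hl0 hA hB hp hlp hα
  coact := cofreeForm_fromCofree_coact hl hl0 hA hB hp hlp hgH hgA hgB

end CofreeTwist

theorem mainTheorem8 (k H A B : Type u) [Field k]
    [Ring H] [HopfAlgebra k H] [FiniteDimensional k H]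
    [Ring A] [Algebra k A] [FiniteDimensional k A] [LeftComoduleAlgebra k H A]
    [Ring B] [Algebra k B] [FiniteDimensional k B] [LeftComoduleAlgebra k H B]
    -- a non-zero right cointegral on `H` and the distinguished grouplike element
    (lH : Module.Dual k H) (hlH : IsRightCointegral lH) (hlH0 : lH ≠ 0)
    (gH : H) (hgH : ∀ h : H, contractCoaction (Coalgebra.comul (R := k) (A := H)) lH h = lH h • gH)
    -- a non-zero left integral in `H` and the left modular function
    (L : H) (hL : IsLeftIntegral (k := k) L) (hL0 : L ≠ 0)
    (αH : Module.Dual k H) (hαH : ∀ h : H, L * h = αH h • L)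
    -- non-degenerate grouplike-cointegrals on `A` and `B`
    (gA : GroupLike k H) (lA : Module.Dual k A) (hlA : IsGCointegral gA lA)
    (hlA' : IsFrobeniusTrace lA)
    (gB : GroupLike k H) (lB : Module.Dual k B) (hlB : IsGCointegral gB lB)
    (hlB' : IsFrobeniusTrace lB) :
    ∃ h : ∀ M : RelHopfBimod k H A B,
        IsRelHopfBimod (nakayamaTwist gA gB gH αH (nakayamaAut hlA') (nakayamaAut hlB') M.toData),
      IsNakayamaFunctor k
        (nakayamaTwistFunctor gA gB gH αH (nakayamaAut hlA') (nakayamaAut hlB') h) := by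
  obtain ⟨p, hp, hlp, hp'⟩ := hlH.exists_isLeftIntegral hlH0
  -- The given integral is a non-zero multiple of the normalized one, so both have the same modular
  -- function.
  obtain ⟨c, rfl⟩ := hlH.mul_integral_eq_smul hlH0 hp' hL
  have hα : ∀ h, p * h = αH h • p := fun h =>
    smul_right_injective H (left_ne_zero_of_smul hL0) <|
      (smul_mul_assoc c p h).symm.trans ((hαH h).trans (smul_comm _ _ _))
  have hG := cofreeGenerator_isTwistedBy hlH hlH0 hlA' hlB' hp hlp hp' hgH hlA hlB hα
  exact ⟨hG.isRelHopfBimod, hG.isNakayamaFunctor⟩
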